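/- Let $N\ge 1$ and let $\alpha,\eta,\theta,R$ be real $N\times N$ matrices with $\alpha^{T}=\alpha>0$, $\eta^{T}=\eta>0$, $\theta^{T}=-\theta$, $R^{T}=R\ge 0$ and $0<N_R:=\operatorname{rank}R<N$. For $\beta\ge 0$ consider the system $$\alpha\ddot Q+(2\theta+\beta R)\dot Q+\eta Q=0,\qquad Q(t)\in\mathbb C^N, \tag{1}$$ whose eigenmodes are the solutions $Q(t)=qe^{-i\zeta t}$ with $0\ne q\in\mathbb C^N$. On $H=\mathbb C^{2N}$ put $A(\beta)=\Omega-i\beta B$, where, with $K_p=\sqrt{\alpha}^{\,-1}$ and $\Phi=\sqrt{\eta}\,K_p^{T}$, $$\Omega=\begin{bmatrix}-2iK_p\theta K_p^{T}&-i\Phi^{T}\\ i\Phi&0\end{bmatrix},\qquad B=\begin{bmatrix}K_pRK_p^{T}&0\\0&0\end{bmatrix}.$$ Let $\omega_{\max}$ and $\omega_{\min}$ be the largest and the smallest positive eigenvalue of $\Omega$, let $b_{\min}$ be the smallest nonzero eigenvalue of $B$, let $P_B^{\perp}$ be the orthogonal projection of $H$ onto $\operatorname{Ker}B$, and let $\rho_{\min}$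 be the smallest positive eigenvalue of $P_B^{\perp}\Omega P_B^{\perp}$. For $y>0$ put $$c^{-1}(y)=\frac{2\omega_{\max}^2}{b_{\min}}\,y^{-1}+\frac{2\omega_{\max}}{b_{\min}},$$ which is the inverse of $c(\beta)=\frac{2\omega_{\max}^2}{b_{\min}}\bigl(\beta-\frac{2\omega_{\max}}{b_{\min}}\bigr)^{-1}$, $\beta>\frac{2\omega_{\max}}{b_{\min}}$. A superscript $\flat$ denotes the same object for the dual system, obtained from (1) by interchanging $\alpha$ and $\eta$. For an eigenvalue $\zeta$ of $A(\beta)$ the quality factor is $Q_\zeta=\frac12\,\frac{|\operatorname{Re}\zeta|}{-\operatorname{Im}\zeta}$, with $Q_\zeta=+\infty$ if $\operatorname{Im}\zeta=0\ne\operatorname{Re}\zeta$ and $Q_\zeta=0$ if $\zeta=0$. Define $$\beta_2=\max\Bigl\{\min\bigl\{c^{-1}(\rho_{\min}/2),\,(c^{\flat})^{-1}(\rho^{\flat}_{\min}/2)\bigr\},\ \frac{2\omega_{\max}}{b_{\min}},\ \frac{2\omega^{\flat}_{\max}}{b^{\flat}_{\min}}\Bigr\}.$$ Then for every $\beta>\beta_2$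 the following hold. 1. Let $\sigma_0$ be the set of $\zeta\in\sigma(A(\beta))$ with $|\zeta|\le\omega_{\max}$, and $\sigma_1$ the set of $\zeta\in\sigma(A(\beta))$ with $|\zeta+i\beta b|\le\omega_{\max}$ for some nonzero eigenvalue $b$ of $B$. Then $\sigma(A(\beta))=\sigma_0\cup\sigma_1$ and $\sigma_0\cap\sigma_1=\emptyset$, and there are unique $A(\beta)$-invariant subspaces $H_{h\ell}(\beta)$, $H_{\ell\ell}(\beta)$ with $H=H_{h\ell}(\beta)\oplus H_{\ell\ell}(\beta)$, $\sigma(A(\beta)|_{H_{\ell\ell}(\beta)})=\sigma_0$ and $\sigma(A(\beta)|_{H_{h\ell}(\beta)})=\sigma_1$. Here $\dim H_{h\ell}(\beta)=N_R$ and $\dim H_{\ell\ell}(\beta)=2N-N_R$. 2. There are unique $A(\beta)$-invariant subspaces $H_{\ell\ell,0}(\beta)$, $H_{\ell\ell,1}(\beta)$ with $H_{\ell\ell}(\beta)=H_{\ell\ell,0}(\beta)\oplus H_{\ell\ell,1}(\beta)$, $\sigma(A(\beta)|_{H_{\ell\ell,0}(\beta)})=\{\zeta\in\sigma(A(\beta)):|\zeta|<\omega_{\min}\}$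 and $\sigma(A(\beta)|_{H_{\ell\ell,1}(\beta)})=\{\zeta\in\sigma(A(\beta)):\omega_{\min}\le|\zeta|\le\omega_{\max}\}$. Their dimensions are $N_R$ and $2N-2N_R$, respectively. Moreover $$\sigma(A|_{H_{\ell\ell,0}})=-\overline{\sigma(A|_{H_{\ell\ell,0}})}=-\sigma(A^{\flat}|_{H^{\flat}_{h\ell}})^{-1},\qquad \sigma(A|_{H_{h\ell}})=-\overline{\sigma(A|_{H_{h\ell}})}=-\sigma(A^{\flat}|_{H^{\flat}_{\ell\ell,0}})^{-1},$$ $$\sigma(A|_{H_{\ell\ell,1}})=-\overline{\sigma(A|_{H_{\ell\ell,1}})}=-\sigma(A^{\flat}|_{H^{\flat}_{\ell\ell,1}})^{-1},$$ where all operators and subspaces are taken at $\beta$, the bar is complex conjugation, and operations on sets are elementwise. 3. The minimum of $Q_\zeta$ over $\zeta\in\sigma(A(\beta)|_{H_{\ell\ell,1}(\beta)})$ exists and is greater than $\frac12$; thus every such $\zeta$ has $Q_\zeta>\frac12$. In particular $\operatorname{Re}\zeta\ne0$ for every such $\zeta$. Consequently these modes are underdamped: if $\zeta(\beta)\in\sigma(A(\beta)|_{H_{\ell\ell,1}(\beta)})$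 for all $\beta>\beta_2$, then there is $\beta'\ge0$ such that for all $\beta>\beta'$ system (1) has an eigenmode with time dependency $e^{-i\zeta(\beta)t}$ and $\operatorname{Re}\zeta(\beta)\neq0$. -/

import Mathlib

open scoped MatrixOrder

noncomputable section

/-- A linear Lagrangian system `α Q'' + (2 θ + β R) Q' + η Q = 0` with `N` degrees of freedom:
real `N × N` matrices with `αᵀ = α > 0`, `ηᵀ = η ≥ 0`, `θᵀ = -θ`, `Rᵀ = R ≥ 0`, `rank R > 0`. -/
structure LagrangianSystem (N : ℕ) where
  α : Matrix (Fin N) (Fin N) ℝ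
  η : Matrix (Fin N) (Fin N) ℝ
  θ : Matrix (Fin N) (Fin N) ℝ
  R : Matrix (Fin N) (Fin N) ℝ
  α_posDef : α.PosDef
  η_posSemidef : η.PosSemidef
  θ_skew : θ.transpose = -θ
  R_posSemidef : R.PosSemidef
  R_rank_pos : 0 < R.rank

/-- The state space `H = ℂ^{2N} = ℂ^N ⊕ ℂ^N` with the standard inner product. -/
abbrev StateSpace (N : ℕ) : Type := EuclideanSpace ℂ (Fin N ⊕ Fin N)

/-- The set of eigenvalues of the restriction `T|_W`, for an invariant subspace `W` of `T`. -/
def restrictedSpectrum {V : Type*} [AddCommGroup V] [Module ℂ V]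
    (T : Module.End ℂ V) (W : Submodule ℂ V) : Set ℂ :=
  {ζ | ∃ w ∈ W, w ≠ 0 ∧ T w = ζ • w}

/-- On an invariant subspace of a finite-dimensional space, `restrictedSpectrum` is the spectrum
of the restricted operator. -/
theorem restrictedSpectrum_eq_spectrum {V : Type*} [AddCommGroup V] [Module ℂ V]
    [FiniteDimensional ℂ V] (T : Module.End ℂ V) (W : Submodule ℂ V) (hW : ∀ w ∈ W, T w ∈ W) :
    restrictedSpectrum T W = spectrum ℂ (T.restrict hW : Module.End ℂ W) := by
  ext ζ
  rw [← Module.End.hasEigenvalue_iff_mem_spectrum]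
  constructor
  · rintro ⟨w, hw, h0, h⟩
    refine Module.End.hasEigenvalue_of_hasEigenvector (x := (⟨w, hw⟩ : W)) ?_
    refine ⟨Module.End.mem_eigenspace_iff.2 (Subtype.ext ?_), ?_⟩
    · simpa using h
    · simpa [Subtype.ext_iff] using h0
  · intro h
    obtain ⟨w, hw⟩ := h.exists_hasEigenvector
    refine ⟨w, w.2, ?_, ?_⟩
    · simpa using hw.2
    · have := congrArg Subtype.val hw.apply_eq_smul
      simpa using this

/-- The sum of the algebraic (generalized) eigenspaces of `T` over the eigenvalues in `s`. -/
def spectralSubspace {V : Type*} [AddCommGroup V] [Module ℂ V]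
    (T : Module.End ℂ V) (s : Set ℂ) : Submodule ℂ V :=
  ⨆ ζ ∈ s, T.maxGenEigenspace ζ

/-- The quality factor `(1/2) |Re ζ| / (-Im ζ)`, with the convention that it is `+∞` if
`Im ζ = 0` and `Re ζ ≠ 0`, and `0` if `ζ = 0`. -/
def qFactor (ζ : ℂ) : EReal :=
  if ζ = 0 then 0
  else if ζ.im = 0 then ⊤
  else (((1 / 2) * (|ζ.re| / (-ζ.im)) : ℝ) : EReal)

namespace LagrangianSystem

variable {N : ℕ} (S : LagrangianSystem N)

/-- The dual system, obtained by interchanging `α` and `η`. -/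
def dual (h : S.η.PosDef) : LagrangianSystem N where
  α := S.η
  η := S.α
  θ := S.θ
  R := S.R
  α_posDef := h
  η_posSemidef := S.α_posDef.posSemidef
  θ_skew := S.θ_skew
  R_posSemidef := S.R_posSemidef
  R_rank_pos := S.R_rank_pos

/-! The equations of motion and their eigenmodes. -/

/-- `Q : ℝ → ℂ^N` is a solution of the equations of motion with loss parameter `β`. -/
def IsSolution (β : ℝ) (Q : ℝ → Fin N → ℂ) : Prop :=
  ContDiff ℝ 2 Q ∧ ∀ t : ℝ,
    (S.α.map Complex.ofReal).mulVec (deriv (deriv Q) t)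
      + (((2 : ℝ) • S.θ + β • S.R).map Complex.ofReal).mulVec (deriv Q t)
      + (S.η.map Complex.ofReal).mulVec (Q t) = 0

/-- `Q(t) = q e^{-iζt}`, `q ≠ 0`, is an eigenmode of the system with loss parameter `β`. -/
def IsEigenmode (β : ℝ) (ζ : ℂ) (q : Fin N → ℂ) : Prop :=
  q ≠ 0 ∧ S.IsSolution β (fun t : ℝ => Complex.exp (-Complex.I * ζ * t) • q)

/-- The modes with time dependency `e^{-iζ(β)t}` are underdamped: from some `β'` on, `ζ(β)` belongs
to an eigenmode and has nonzero frequency `Re ζ(β)`. -/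
def IsUnderdamped (ζ : ℝ → ℂ) : Prop :=
  ∃ β' : ℝ, 0 ≤ β' ∧ ∀ β : ℝ, β' < β → (∃ q, S.IsEigenmode β (ζ β) q) ∧ (ζ β).re ≠ 0

/-! The canonical system `∂ₜ v = -i A(β) v`, `A(β) = Ω - i β B`. -/

/-- `K_p = (√α)⁻¹`. -/
def Kp : Matrix (Fin N) (Fin N) ℝ := (CFC.sqrt S.α)⁻¹

/-- `K_q = √η`. -/
def Kq : Matrix (Fin N) (Fin N) ℝ := CFC.sqrt S.η

/-- `Φ = K_q K_pᵀ`. -/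
def Phi : Matrix (Fin N) (Fin N) ℝ := S.Kq * S.Kp.transpose

/-- `Ω_p = -2i K_p θ K_pᵀ`. -/
def OmegaP : Matrix (Fin N) (Fin N) ℂ :=
  (-(2 * Complex.I)) • (S.Kp * S.θ * S.Kp.transpose).map Complex.ofReal

/-- The matrix `Ω = [Ω_p, -iΦᵀ; iΦ, 0]`. -/
def OmegaMatrix : Matrix (Fin N ⊕ Fin N) (Fin N ⊕ Fin N) ℂ :=
  Matrix.fromBlocks S.OmegaP ((-Complex.I) • S.Phi.transpose.map Complex.ofReal)
    (Complex.I • S.Phi.map Complex.ofReal) 0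

/-- The matrix `B = [K_p R K_pᵀ, 0; 0, 0]`. -/
def BMatrix : Matrix (Fin N ⊕ Fin N) (Fin N ⊕ Fin N) ℂ :=
  Matrix.fromBlocks ((S.Kp * S.R * S.Kp.transpose).map Complex.ofReal) 0 0 0

/-- `Ω` as an operator on `H`. -/
def Omega : Module.End ℂ (StateSpace N) := Matrix.toEuclideanLin S.OmegaMatrix

/-- `B` as an operator on `H`. -/
def B : Module.End ℂ (StateSpace N) := Matrix.toEuclideanLin S.BMatrix

/-- The system operator `A(β) = Ω - i β B`. -/
def A (β : ℝ) : Module.End ℂ (StateSpace N) := S.Omega - (Complex.I * (β : ℂ)) • S.B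

/-- `P_B^⊥ Ω P_B^⊥`, where `P_B^⊥` is the orthogonal projection of `H` onto `Ker B`. -/
def compressedOmega : Module.End ℂ (StateSpace N) :=
  ((LinearMap.ker S.B).starProjection : Module.End ℂ (StateSpace N)) * S.Omega *
    ((LinearMap.ker S.B).starProjection : Module.End ℂ (StateSpace N))

/-! Spectral constants. -/

/-- `ω_max`, the largest eigenvalue of `Ω`. -/
def omegaMax : ℝ := sSup {ω : ℝ | (ω : ℂ) ∈ spectrum ℂ S.Omega}

/-- `ω_min`, the smallest positive eigenvalue of `Ω`. -/
def omegaMin : ℝ := sInf {ω : ℝ | 0 < ω ∧ (ω : ℂ) ∈ spectrum ℂ S.Omega}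

/-- `b_min`, the smallest nonzero eigenvalue of `B`. -/
def bMin : ℝ := sInf {b : ℝ | b ≠ 0 ∧ (b : ℂ) ∈ spectrum ℂ S.B}

/-- `ρ_min`, the smallest positive eigenvalue of `P_B^⊥ Ω P_B^⊥`. -/
def rhoMin : ℝ := sInf {ρ : ℝ | 0 < ρ ∧ (ρ : ℂ) ∈ spectrum ℂ S.compressedOmega}

/-- `c(β) = (2 ω_max² / b_min) (β - 2 ω_max / b_min)⁻¹`, for `β > 2 ω_max / b_min`. -/
def c (β : ℝ) : ℝ := (2 * S.omegaMax ^ 2 / S.bMin) * (β - 2 * S.omegaMax / S.bMin)⁻¹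

/-- `c⁻¹(y) = (2 ω_max² / b_min) y⁻¹ + 2 ω_max / b_min`, for `y > 0`. -/
def cInv (y : ℝ) : ℝ := (2 * S.omegaMax ^ 2 / S.bMin) * y⁻¹ + 2 * S.omegaMax / S.bMin

theorem c_cInv (hω : S.omegaMax ≠ 0) (hb : S.bMin ≠ 0) {y : ℝ} (hy : 0 < y) :
    S.c (S.cInv y) = y := by
  unfold c cInv
  field_simp
  simp [hω]

theorem cInv_c (hω : S.omegaMax ≠ 0) (hb : S.bMin ≠ 0) {β : ℝ}
    (hβ : 2 * S.omegaMax / S.bMin < β) : S.cInv (S.c β) = β := by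
  have h : β - 2 * S.omegaMax / S.bMin ≠ 0 := (sub_pos.2 hβ).ne'
  have h2 : 2 * S.omegaMax ^ 2 / S.bMin ≠ 0 := by positivity
  unfold c cInv
  rw [mul_inv, inv_inv, mul_inv_cancel_left₀ h2]
  ring

/-- The threshold `β₂`. -/
def beta2 (h : S.η.PosDef) : ℝ :=
  max (min (S.cInv (S.rhoMin / 2)) ((S.dual h).cInv ((S.dual h).rhoMin / 2)))
    (max (2 * S.omegaMax / S.bMin) (2 * (S.dual h).omegaMax / (S.dual h).bMin))

/-! First splitting: high-loss and low-loss subspaces. -/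

/-- `σ₀(A(β))`: the spectrum in the disc of radius `ω_max` about `0`. -/
def sigma0 (β : ℝ) : Set ℂ := spectrum ℂ (S.A β) ∩ Metric.closedBall 0 S.omegaMax

/-- `σ₁(A(β))`: the spectrum in the discs of radius `ω_max` about the points `-iβb`,
`b` a nonzero eigenvalue of `B`. -/
def sigma1 (β : ℝ) : Set ℂ :=
  spectrum ℂ (S.A β) ∩
    ⋃ b ∈ {b : ℝ | b ≠ 0 ∧ (b : ℂ) ∈ spectrum ℂ S.B},
      Metric.closedBall (-(Complex.I * (β : ℂ) * (b : ℂ))) S.omegaMax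

/-- The defining properties of the high-loss and low-loss subspaces. -/
structure IsSplittingI (β : ℝ) (Hh Hl : Submodule ℂ (StateSpace N)) : Prop where
  invariant_h : ∀ w ∈ Hh, S.A β w ∈ Hh
  invariant_l : ∀ w ∈ Hl, S.A β w ∈ Hl
  isCompl : IsCompl Hh Hl
  spectrum_l : restrictedSpectrum (S.A β) Hl = S.sigma0 β
  spectrum_h : restrictedSpectrum (S.A β) Hh = S.sigma1 β

/-- The high-loss subspace `H_{hℓ}(β)`. -/
def Hhl (β : ℝ) : Submodule ℂ (StateSpace N) := spectralSubspace (S.A β) (S.sigma1 β)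

/-- The low-loss subspace `H_{ℓℓ}(β)`. -/
def Hll (β : ℝ) : Submodule ℂ (StateSpace N) := spectralSubspace (S.A β) (S.sigma0 β)

/-- Modal dichotomy: the spectrum of `A(β)` splits into the disjoint sets `σ₀` and `σ₁`, and
`H_{hℓ}(β)`, `H_{ℓℓ}(β)` are the unique invariant subspaces realizing this splitting; their
dimensions are `N_R` and `2N - N_R`. -/
structure ModalDichotomyI (β : ℝ) : Prop where
  spectrum_union : spectrum ℂ (S.A β) = S.sigma0 β ∪ S.sigma1 β
  spectrum_disjoint : S.sigma0 β ∩ S.sigma1 β = ∅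
  splitting : S.IsSplittingI β (S.Hhl β) (S.Hll β)
  unique : ∀ Hh Hl, S.IsSplittingI β Hh Hl → Hh = S.Hhl β ∧ Hl = S.Hll β
  finrank_h : Module.finrank ℂ (S.Hhl β) = S.R.rank
  finrank_l : Module.finrank ℂ (S.Hll β) = 2 * N - S.R.rank

/-! Second splitting: low-loss/low-Q and low-loss/high-Q subspaces. -/

/-- The eigenvalues `ζ` of `A(β)` with `|ζ| < ω_min`. -/
def sigmaLow (β : ℝ) : Set ℂ := spectrum ℂ (S.A β) ∩ {ζ | ‖ζ‖ < S.omegaMin}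

/-- The eigenvalues `ζ` of `A(β)` with `ω_min ≤ |ζ| ≤ ω_max`. -/
def sigmaMid (β : ℝ) : Set ℂ :=
  spectrum ℂ (S.A β) ∩ {ζ | S.omegaMin ≤ ‖ζ‖ ∧ ‖ζ‖ ≤ S.omegaMax}

/-- The defining properties of the low-loss/low-Q and low-loss/high-Q subspaces. -/
structure IsSplittingII (β : ℝ) (H0 H1 : Submodule ℂ (StateSpace N)) : Prop where
  invariant_0 : ∀ w ∈ H0, S.A β w ∈ H0
  invariant_1 : ∀ w ∈ H1, S.A β w ∈ H1
  sup_eq : H0 ⊔ H1 = S.Hll β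
  disjoint : Disjoint H0 H1
  spectrum_0 : restrictedSpectrum (S.A β) H0 = S.sigmaLow β
  spectrum_1 : restrictedSpectrum (S.A β) H1 = S.sigmaMid β

/-- The low-loss/low-Q subspace `H_{ℓℓ,0}(β)`. -/
def Hll0 (β : ℝ) : Submodule ℂ (StateSpace N) := spectralSubspace (S.A β) (S.sigmaLow β)

/-- The low-loss/high-Q subspace `H_{ℓℓ,1}(β)`. -/
def Hll1 (β : ℝ) : Submodule ℂ (StateSpace N) := spectralSubspace (S.A β) (S.sigmaMid β)

/-- Modal dichotomy and duality: `H_{ℓℓ,0}(β)` and `H_{ℓℓ,1}(β)` are the unique invariant subspaces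
splitting `H_{ℓℓ}(β)` at `|ζ| = ω_min`; their dimensions are `N_R` and `2N - 2N_R`; the spectra are
symmetric about the imaginary axis and correspond to those of the dual system by `ζ ↦ -ζ⁻¹`. -/
structure ModalDichotomyII (h : S.η.PosDef) (β : ℝ) : Prop where
  splitting : S.IsSplittingII β (S.Hll0 β) (S.Hll1 β)
  unique : ∀ H0 H1, S.IsSplittingII β H0 H1 → H0 = S.Hll0 β ∧ H1 = S.Hll1 β
  finrank_0 : Module.finrank ℂ (S.Hll0 β) = S.R.rank
  finrank_1 : Module.finrank ℂ (S.Hll1 β) = 2 * N - 2 * S.R.rank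
  symm_0 : restrictedSpectrum (S.A β) (S.Hll0 β)
    = (fun ζ => -(starRingEnd ℂ) ζ) '' restrictedSpectrum (S.A β) (S.Hll0 β)
  dual_0 : restrictedSpectrum (S.A β) (S.Hll0 β)
    = (fun ζ => -ζ⁻¹) '' restrictedSpectrum ((S.dual h).A β) ((S.dual h).Hhl β)
  symm_h : restrictedSpectrum (S.A β) (S.Hhl β)
    = (fun ζ => -(starRingEnd ℂ) ζ) '' restrictedSpectrum (S.A β) (S.Hhl β)
  dual_h : restrictedSpectrum (S.A β) (S.Hhl β)
    = (fun ζ => -ζ⁻¹) '' restrictedSpectrum ((S.dual h).A β) ((S.dual h).Hll0 β)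
  symm_1 : restrictedSpectrum (S.A β) (S.Hll1 β)
    = (fun ζ => -(starRingEnd ℂ) ζ) '' restrictedSpectrum (S.A β) (S.Hll1 β)
  dual_1 : restrictedSpectrum (S.A β) (S.Hll1 β)
    = (fun ζ => -ζ⁻¹) '' restrictedSpectrum ((S.dual h).A β) ((S.dual h).Hll1 β)

end LagrangianSystem

end

/-! ### Spectral subspaces -/

section SpectralSubspace

variable {V : Type*} [AddCommGroup V] [Module ℂ V]

/-! All subspaces are sums of generalized eigenspaces, so existence and uniqueness of the splittings
are linear algebra. The content lies in locating eigenvalues and counting them with multiplicity.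

Location: an eigenvector of `A(β)` is an approximate eigenvector of the Hermitian `B`, with error
`ω_max / β`, so a Bauer–Fike bound puts every eigenvalue in one of the stated discs
(`spectrum_A_eq_union`).

Counting uses indefinite forms instead of continuation in `β`. With `P` the projection onto `Ker B`,
the form `f(x) = ‖Px‖² - ‖(1 - P)x‖²` satisfies `f(Ax) < s² f(x)` for `s = β b_min / 2`
(`lossForm_A_lt`). Such an inequality makes `f` positive on invariant subspaces with spectrum in
`|ζ| < s` and negative on those with spectrum in `|ζ| > s` (`pos_of_stein`, `neg_of_stein`). Hence
the low-loss space misses `(Ker B)ᗮ`, the high-loss space misses `Ker B`, and complementarity forces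
both dimensions.

Duality: with `J` the exchange of components, `A J A♭ = -J`, so `J` carries eigenvalue `ζ` to `-ζ⁻¹`
and spectral subspaces to spectral subspaces. As `ω_max♭ = ω_min⁻¹`, the eigenvalues with `|ζ| <
ω_min` are the dual high-loss ones, which yields the second splitting.

Quality factor: it suffices that `|Im ζ| < |Re ζ|`. On the low-loss space positivity of `f` bounds
`(1 - P)x` by `Px`, so `Pw` is an approximate eigenvector of `PΩP` with error `c(β) < ρ_min / 2`. So
`ζ` is near a nonzero real eigenvalue, and the inequality holds, or `|ζ| < ρ_min / 2`
(`norm_lt_or_abs_im_lt_abs_re`). A second form shows that at most `N_R` eigenvalues are that small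
(`finrank_sigmaSmall_le`); those below `ω_min` already use up this number. If only the dual
threshold is exceeded, the argument runs for the dual system and is pulled back by `ζ ↦ -ζ⁻¹`. -/

theorem mem_spectrum_iff_exists_eigenvector [FiniteDimensional ℂ V] {T : Module.End ℂ V} {ζ : ℂ} :
    ζ ∈ spectrum ℂ T ↔ ∃ w, w ≠ 0 ∧ T w = ζ • w := by
  rw [← Module.End.hasEigenvalue_iff_mem_spectrum]
  constructor
  · intro h
    obtain ⟨w, hw⟩ := h.exists_hasEigenvector
    exact ⟨w, hw.2, hw.apply_eq_smul⟩
  · rintro ⟨w, h0, h⟩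
    exact Module.End.hasEigenvalue_of_hasEigenvector (x := w)
      ⟨Module.End.mem_eigenspace_iff.2 h, h0⟩

theorem restrictedSpectrum_subset_spectrum [FiniteDimensional ℂ V] (T : Module.End ℂ V)
    (W : Submodule ℂ V) : restrictedSpectrum T W ⊆ spectrum ℂ T := by
  rintro ζ ⟨w, -, h0, h⟩
  exact mem_spectrum_iff_exists_eigenvector.2 ⟨w, h0, h⟩

theorem spectralSubspace_mono (T : Module.End ℂ V) {s t : Set ℂ} (h : s ⊆ t) :
    spectralSubspace T s ≤ spectralSubspace T t :=
  biSup_mono fun _ hζ => h hζ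

theorem mem_spectralSubspace_of_eigenvector {T : Module.End ℂ V} {s : Set ℂ} {ζ : ℂ} (hζ : ζ ∈ s)
    {w : V} (h : T w = ζ • w) : w ∈ spectralSubspace T s :=
  (le_biSup T.maxGenEigenspace hζ)
    (Module.End.eigenspace_le_maxGenEigenspace (Module.End.mem_eigenspace_iff.2 h))

theorem spectralSubspace_invariant (T : Module.End ℂ V) (s : Set ℂ) :
    ∀ w ∈ spectralSubspace T s, T w ∈ spectralSubspace T s := by
  intro w hw
  have h : spectralSubspace T s ≤ (spectralSubspace T s).comap T := by
    refine iSup₂_le fun ζ hζ x hx => ?_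
    exact (le_biSup T.maxGenEigenspace hζ)
      (Module.End.mapsTo_maxGenEigenspace_of_comm (Commute.refl T) ζ hx)
  exact h hw

theorem disjoint_spectralSubspace (T : Module.End ℂ V) {s t : Set ℂ} (h : Disjoint s t) :
    Disjoint (spectralSubspace T s) (spectralSubspace T t) :=
  T.independent_maxGenEigenspace.disjoint_biSup_biSup h

theorem spectralSubspace_union (T : Module.End ℂ V) (s t : Set ℂ) :
    spectralSubspace T (s ∪ t) = spectralSubspace T s ⊔ spectralSubspace T t :=
  iSup_union

/-- Independence of generalized eigenspaces rules out an eigenvector whose eigenvalue lies outside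
`s`. -/
theorem restrictedSpectrum_spectralSubspace [FiniteDimensional ℂ V] (T : Module.End ℂ V)
    {s : Set ℂ} (hs : s ⊆ spectrum ℂ T) : restrictedSpectrum T (spectralSubspace T s) = s := by
  ext ζ
  constructor
  · rintro ⟨w, hw, h0, h⟩
    by_contra hζ
    have hd := disjoint_spectralSubspace T (Set.disjoint_singleton_right.2 hζ)
    exact h0 (Submodule.disjoint_def.1 hd w hw
      (mem_spectralSubspace_of_eigenvector (Set.mem_singleton ζ) h))
  · intro hζ
    obtain ⟨w, h0, h⟩ := mem_spectrum_iff_exists_eigenvector.1 (hs hζ)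
    exact ⟨w, mem_spectralSubspace_of_eigenvector hζ h, h0, h⟩

/-- An invariant subspace is the sum of its intersections with the generalized eigenspaces, and a
nonzero intersection produces an eigenvalue of the restriction. This is the source of all uniqueness
claims. -/
theorem le_spectralSubspace [FiniteDimensional ℂ V] (T : Module.End ℂ V) {W : Submodule ℂ V}
    (hW : ∀ w ∈ W, T w ∈ W) {s : Set ℂ} (hs : restrictedSpectrum T W ⊆ s) :
    W ≤ spectralSubspace T s := by
  have h := Submodule.eq_iSup_inf_genEigenspace (p := W) (f := T) ⊤ hW
    (Module.End.iSup_maxGenEigenspace_eq_top T)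
  rw [h]
  refine iSup_le fun ζ => ?_
  by_cases hζ : ζ ∈ s
  · exact inf_le_right.trans (le_biSup T.maxGenEigenspace hζ)
  · rw [Submodule.inf_genEigenspace T W hW]
    have h2 : Module.End.genEigenspace (LinearMap.restrict T hW : Module.End ℂ W) ζ ⊤ = ⊥ := by
      by_contra h3
      refine hζ (hs ?_)
      rw [restrictedSpectrum_eq_spectrum T W hW, ← Module.End.hasEigenvalue_iff_mem_spectrum]
      exact Module.End.HasUnifEigenvalue.lt one_pos h3
    rw [h2]
    simp

theorem spectralSubspace_spectrum [FiniteDimensional ℂ V] (T : Module.End ℂ V) :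
    spectralSubspace T (spectrum ℂ T) = ⊤ :=
  top_le_iff.1 (le_spectralSubspace T (fun _ _ => Submodule.mem_top)
    (restrictedSpectrum_subset_spectrum T ⊤))

/-- The modular law: the summands of a direct sum cannot shrink without shrinking the sum. -/
theorem eq_and_eq_of_le_of_sup_eq {W₁ W₂ K₁ K₂ : Submodule ℂ V} (h₁ : W₁ ≤ K₁) (h₂ : W₂ ≤ K₂)
    (hK : Disjoint K₁ K₂) (hs : W₁ ⊔ W₂ = K₁ ⊔ K₂) : W₁ = K₁ ∧ W₂ = K₂ := by
  have key : ∀ {W₁ W₂ K₁ K₂ : Submodule ℂ V}, W₁ ≤ K₁ → W₂ ≤ K₂ → Disjoint K₁ K₂ →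
      W₁ ⊔ W₂ = K₁ ⊔ K₂ → W₁ = K₁ := by
    intro W₁ W₂ K₁ K₂ h₁ h₂ hK hs
    refine le_antisymm h₁ ?_
    calc K₁ ≤ (W₁ ⊔ W₂) ⊓ K₁ := le_inf (hs ▸ le_sup_left) le_rfl
      _ = W₁ ⊔ W₂ ⊓ K₁ := (sup_inf_assoc_of_le _ h₁)
      _ ≤ W₁ := sup_le le_rfl ((inf_le_inf_right _ h₂).trans (hK.symm.le_bot.trans bot_le))
  exact ⟨key h₁ h₂ hK hs, key h₂ h₁ hK.symm (by rw [sup_comm, hs, sup_comm])⟩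

end SpectralSubspace

/-! ### A definiteness criterion of Stein type -/

section Stein

open Filter Topology

variable {V : Type*} [NormedAddCommGroup V] [NormedSpace ℂ V] [FiniteDimensional ℂ V]

/-- Gelfand's formula gives `‖M ^ n‖ ≤ r ^ n` eventually, for some `r < s` above the spectral
radius. -/
theorem tendsto_pow_apply_zero_of_eigenvalues_lt (M : Module.End ℂ V) {s : ℝ} (hs0 : 0 < s)
    (hs : ∀ ζ ∈ spectrum ℂ M, ‖ζ‖ < s) (x : V) :
    Tendsto (fun n : ℕ => (((s : ℂ)⁻¹) ^ n) • (M ^ n) x) atTop (𝓝 0) := by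
  rcases subsingleton_or_nontrivial V with hV | hV
  · exact tendsto_const_nhds.congr fun n => Subsingleton.elim _ _
  let e : Module.End ℂ V ≃ₐ[ℂ] (V →L[ℂ] V) := Module.End.toContinuousLinearMap V
  let a : V →L[ℂ] V := e M
  have : CompleteSpace V := FiniteDimensional.complete ℂ V
  have hsp : spectrum ℂ a = spectrum ℂ M := AlgEquiv.spectrum_eq e M
  have hr : spectralRadius ℂ a < (s.toNNReal : ENNReal) := by
    apply spectrum.spectralRadius_lt_of_forall_lt
    intro z hz
    rw [hsp] at hz
    rw [← NNReal.coe_lt_coe, Real.coe_toNNReal s hs0.le]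
    exact hs z hz
  obtain ⟨r, hr1, hr2⟩ := ENNReal.lt_iff_exists_nnreal_btwn.1 hr
  have hr2' : (r : ℝ) < s := by
    have := NNReal.coe_lt_coe.2 (ENNReal.coe_lt_coe.1 hr2)
    rwa [Real.coe_toNNReal s hs0.le] at this
  have hbound : ∀ᶠ n : ℕ in atTop, ‖a ^ n‖ ≤ (r : ℝ) ^ n := by
    have hlim := spectrum.pow_nnnorm_pow_one_div_tendsto_nhds_spectralRadius a
    filter_upwards [hlim.eventually_lt_const hr1, eventually_gt_atTop 0] with n hn hn0
    have h1 : ((‖a ^ n‖₊ : ENNReal) ^ (1 / n : ℝ)) ^ n ≤ (r : ENNReal) ^ n :=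
      pow_le_pow_left' hn.le n
    rw [← ENNReal.rpow_natCast, ← ENNReal.rpow_mul,
      one_div_mul_cancel (by exact_mod_cast hn0.ne'), ENNReal.rpow_one] at h1
    exact_mod_cast h1
  refine squeeze_zero_norm' (a := fun n => ((r : ℝ) / s) ^ n * ‖x‖) ?_ ?_
  · filter_upwards [hbound] with n hn
    have hMn : (M ^ n) x = (a ^ n) x := by
      have : a ^ n = e (M ^ n) := (map_pow e M n).symm
      rw [this]; rfl
    rw [norm_smul, norm_pow, norm_inv, Complex.norm_real, Real.norm_of_nonneg hs0.le, hMn, div_pow,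
      div_mul_eq_mul_div, inv_pow, inv_mul_eq_div]
    gcongr
    exact ((a ^ n).le_opNorm x).trans (by gcongr)
  · rw [← zero_mul ‖x‖]
    exact (tendsto_pow_atTop_nhds_zero_of_lt_one (by positivity)
      ((div_lt_one hs0).2 hr2')).mul_const _

/-- Along the orbit of `M / s` the values of `f` do not increase, while the orbit tends to `0`;
hence `f ≥ 0`. One strict step, `0 ≤ f (M x) < s ^ 2 * f x`, then gives positivity. -/
theorem pos_of_stein (M : Module.End ℂ V) {s : ℝ} (hs0 : 0 < s)
    (hs : ∀ ζ ∈ spectrum ℂ M, ‖ζ‖ < s) {f : V → ℝ} (hf : Continuous f)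
    (hhom : ∀ (c : ℂ) x, f (c • x) = ‖c‖ ^ 2 * f x)
    (hlt : ∀ x, x ≠ 0 → f (M x) < s ^ 2 * f x) {x : V} (hx : x ≠ 0) : 0 < f x := by
  have hf0 : f 0 = 0 := by simpa using hhom 0 0
  have hle : ∀ x, f (M x) ≤ s ^ 2 * f x := by
    intro x
    rcases eq_or_ne x 0 with rfl | h
    · simp [hf0]
    · exact (hlt x h).le
  have hg : ∀ (n : ℕ) (y : V), f ((((s : ℂ)⁻¹) ^ n) • (M ^ n) y) ≤ f y := by
    intro n
    induction n with
    | zero => intro y; simp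
    | succ n ih =>
      intro y
      refine le_trans ?_ (ih y)
      rw [hhom, hhom, pow_succ' M, Module.End.mul_apply]
      simp only [norm_pow, norm_inv, Complex.norm_real, Real.norm_of_nonneg hs0.le]
      calc ((s⁻¹) ^ (n + 1)) ^ 2 * f (M ((M ^ n) y))
          ≤ ((s⁻¹) ^ (n + 1)) ^ 2 * (s ^ 2 * f ((M ^ n) y)) := by gcongr; exact hle _
        _ = ((s⁻¹) ^ n) ^ 2 * f ((M ^ n) y) := by
          rw [pow_succ s⁻¹ n]; field_simp
  have hnonneg : ∀ y, 0 ≤ f y := by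
    intro y
    have h1 := (hf.tendsto 0).comp (tendsto_pow_apply_zero_of_eigenvalues_lt M hs0 hs y)
    rw [hf0] at h1
    exact le_of_tendsto h1 (Eventually.of_forall fun n => hg n y)
  have h1 := hlt x hx
  have h2 := hnonneg (M x)
  exact pos_of_mul_pos_right (h2.trans_lt h1) (by positivity)

/-- `M` is invertible, and `pos_of_stein` applies to `M⁻¹`, `s⁻¹` and `-f`. -/
theorem neg_of_stein (M : Module.End ℂ V) {s : ℝ} (hs0 : 0 < s)
    (hs : ∀ ζ ∈ spectrum ℂ M, s < ‖ζ‖) {f : V → ℝ} (hf : Continuous f)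
    (hhom : ∀ (c : ℂ) x, f (c • x) = ‖c‖ ^ 2 * f x)
    (hlt : ∀ x, x ≠ 0 → f (M x) < s ^ 2 * f x) {x : V} (hx : x ≠ 0) : f x < 0 := by
  have hker : LinearMap.ker M = ⊥ := by
    rw [LinearMap.ker_eq_bot']
    intro m hm
    by_contra hm0
    have := hs 0 (mem_spectrum_iff_exists_eigenvector.2 ⟨m, hm0, by simpa using hm⟩)
    simp at this
    linarith
  let e : V ≃ₗ[ℂ] V := LinearEquiv.ofInjectiveEndo M (LinearMap.ker_eq_bot.1 hker)
  have he : ∀ y, M (e.symm y) = y := fun y => e.apply_symm_apply y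
  have h := pos_of_stein (e.symm : Module.End ℂ V) (s := s⁻¹) (by positivity) ?_
    (f := fun y => - f y) hf.neg (by intro c y; simp only [hhom]; ring) ?_ hx
  · linarith
  · intro ζ hζ
    obtain ⟨w, hw0, hw⟩ := mem_spectrum_iff_exists_eigenvector.1 hζ
    replace hw : e.symm w = ζ • w := hw
    have h1 : w = ζ • M w := by rw [← map_smul, ← hw, he]
    have hζ0 : ζ ≠ 0 := by rintro rfl; exact hw0 (by simpa using h1)
    have h2 : s < ‖ζ⁻¹‖ := hs _ (mem_spectrum_iff_exists_eigenvector.2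
      ⟨w, hw0, by conv_rhs => rw [h1, smul_smul, inv_mul_cancel₀ hζ0, one_smul]⟩)
    rw [norm_inv] at h2
    exact (lt_inv_comm₀ hs0 (norm_pos_iff.2 hζ0)).1 h2
  · intro y hy
    have h1 := hlt (e.symm y) (by simpa using hy)
    rw [he] at h1
    change - f (e.symm y) < _
    have : (s⁻¹) ^ 2 * f y < (s⁻¹) ^ 2 * (s ^ 2 * f (e.symm y)) := by gcongr
    have h3 : (s⁻¹) ^ 2 * (s ^ 2 * f (e.symm y)) = f (e.symm y) := by field_simp
    linarith

end Stein

/-! ### Symmetric operators -/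

section Symmetric

variable {E : Type*} [NormedAddCommGroup E] [InnerProductSpace ℂ E] [FiniteDimensional ℂ E]

namespace LinearMap.IsSymmetric

variable {T : E →ₗ[ℂ] E} (hT : T.IsSymmetric)
include hT

/-- Parseval in an orthonormal eigenbasis; the estimates below compare weights term by term. -/
theorem norm_sub_smul_sq (ζ : ℂ) (x : E) :
    ‖T x - ζ • x‖ ^ 2 = ∑ i, ‖(hT.eigenvalues rfl i : ℂ) - ζ‖ ^ 2
      * ‖(hT.eigenvectorBasis rfl).repr x i‖ ^ 2 := by
  rw [← (hT.eigenvectorBasis rfl).repr.norm_map, EuclideanSpace.norm_sq_eq]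
  refine Finset.sum_congr rfl fun i _ => ?_
  rw [map_sub, map_smul, PiLp.sub_apply, PiLp.smul_apply, hT.eigenvectorBasis_apply_self_apply,
    smul_eq_mul, ← mul_pow, ← norm_mul, sub_mul]
  rfl

theorem eigenvalues_mem_spectrum (i) :
    ((hT.eigenvalues rfl i : ℝ) : ℂ) ∈ spectrum ℂ (T : Module.End ℂ E) :=
  Module.End.hasEigenvalue_iff_mem_spectrum.1 (hT.hasEigenvalue_eigenvalues rfl i)

theorem ofReal_re_eq_of_mem_spectrum {ζ : ℂ} (hζ : ζ ∈ spectrum ℂ (T : Module.End ℂ E)) :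
    ((ζ.re : ℝ) : ℂ) = ζ :=
  Complex.conj_eq_iff_re.1
    (hT.conj_eigenvalue_eq_self (Module.End.hasEigenvalue_iff_mem_spectrum.2 hζ))

/-- A Bauer–Fike estimate: an approximate eigenvalue is close to an eigenvalue. -/
theorem exists_eigenvalue_near {ζ : ℂ} {c : ℝ} {x : E} (hx : x ≠ 0)
    (h : ‖T x - ζ • x‖ ≤ c * ‖x‖) :
    ∃ μ : ℝ, (μ : ℂ) ∈ spectrum ℂ (T : Module.End ℂ E) ∧ ‖ζ - μ‖ ≤ c := by
  by_contra! hcon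
  have hx' : 0 < ‖x‖ := norm_pos_iff.2 hx
  have hc : 0 ≤ c := nonneg_of_mul_nonneg_left ((norm_nonneg _).trans h) hx'
  have hi : ∀ i, c < ‖(hT.eigenvalues rfl i : ℂ) - ζ‖ := fun i => by
    rw [norm_sub_rev]
    exact hcon _ (hT.eigenvalues_mem_spectrum i)
  have hrepr : ∑ i, ‖(hT.eigenvectorBasis rfl).repr x i‖ ^ 2 = ‖x‖ ^ 2 := by
    rw [← EuclideanSpace.norm_sq_eq, LinearIsometryEquiv.norm_map]
  have hlt : c ^ 2 * ‖x‖ ^ 2 < ‖T x - ζ • x‖ ^ 2 := by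
    rw [hT.norm_sub_smul_sq, ← hrepr, Finset.mul_sum]
    obtain ⟨j, hj⟩ : ∃ j, (hT.eigenvectorBasis rfl).repr x j ≠ 0 := by
      by_contra! h0
      have : ‖x‖ ^ 2 = 0 := by rw [← hrepr]; simp [h0]
      exact hx'.ne' (by simpa using this)
    refine Finset.sum_lt_sum (fun i _ => ?_) ⟨j, Finset.mem_univ j, ?_⟩
    · have := (hi i).le
      gcongr
    · have := hi j
      have := norm_pos_iff.2 hj
      gcongr
  have := pow_le_pow_left₀ (norm_nonneg _) h 2
  rw [mul_pow] at this
  linarith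

theorem norm_apply_le {ω : ℝ} (hω0 : 0 ≤ ω)
    (hω : ∀ μ : ℝ, (μ : ℂ) ∈ spectrum ℂ (T : Module.End ℂ E) → |μ| ≤ ω) (x : E) :
    ‖T x‖ ≤ ω * ‖x‖ := by
  refine le_of_sq_le_sq ?_ (by positivity)
  have h := hT.norm_sub_smul_sq 0 x
  simp only [zero_smul, sub_zero] at h
  rw [h, mul_pow, ← (hT.eigenvectorBasis rfl).repr.norm_map x, EuclideanSpace.norm_sq_eq,
    Finset.mul_sum]
  refine Finset.sum_le_sum fun i _ => ?_
  have := hω _ (hT.eigenvalues_mem_spectrum i)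
  rw [Complex.norm_real, Real.norm_eq_abs]
  gcongr

theorem le_norm_apply {ρ : ℝ} (hρ0 : 0 ≤ ρ)
    (hρ : ∀ μ : ℝ, (μ : ℂ) ∈ spectrum ℂ (T : Module.End ℂ E) → μ ≠ 0 → ρ ≤ |μ|) {x : E}
    (hx : x ∈ (LinearMap.ker T)ᗮ) : ρ * ‖x‖ ≤ ‖T x‖ := by
  refine le_of_sq_le_sq ?_ (norm_nonneg _)
  have h := hT.norm_sub_smul_sq 0 x
  simp only [zero_smul, sub_zero] at h
  rw [h, mul_pow, ← (hT.eigenvectorBasis rfl).repr.norm_map x, EuclideanSpace.norm_sq_eq,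
    Finset.mul_sum]
  refine Finset.sum_le_sum fun i _ => ?_
  rw [Complex.norm_real, Real.norm_eq_abs]
  -- Orthogonality to the kernel kills the coefficients belonging to the eigenvalue `0`.
  rcases eq_or_ne (hT.eigenvalues rfl i) 0 with h0 | h0
  · have : (hT.eigenvectorBasis rfl).repr x i = 0 := by
      rw [OrthonormalBasis.repr_apply_apply]
      refine hx _ ?_
      rw [LinearMap.mem_ker, hT.apply_eigenvectorBasis, h0]
      simp
    rw [this]
    simp
  · have := hρ _ (hT.eigenvalues_mem_spectrum i) h0
    gcongr

end LinearMap.IsSymmetric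

end Symmetric

/-! ### Rank of a complexified matrix -/

/-- Transvections reduce `M` to diagonal form over `K`; the image of this factorization under `f`
does the same over `L`, and `f` preserves which diagonal entries vanish. -/
theorem Matrix.rank_map_field {n K L : Type*} [Fintype n] [DecidableEq n] [Field K] [Field L]
    (f : K →+* L) (M : Matrix n n K) : (M.map f).rank = M.rank := by
  classical
  obtain ⟨l, l', D, h⟩ := Matrix.Pivot.exists_list_transvec_mul_mul_list_transvec_eq_diagonal M
  set P := (l.map Matrix.TransvectionStruct.toMatrix).prod
  set Q := (l'.map Matrix.TransvectionStruct.toMatrix).prod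
  have hP : P.det = 1 := Matrix.TransvectionStruct.det_toMatrix_prod l
  have hQ : Q.det = 1 := Matrix.TransvectionStruct.det_toMatrix_prod l'
  have hPf : (P.map f).det = 1 := by
    have := f.map_det P
    rw [hP, map_one] at this
    exact this.symm
  have hQf : (Q.map f).det = 1 := by
    have := f.map_det Q
    rw [hQ, map_one] at this
    exact this.symm
  have hf : P.map f * M.map f * Q.map f = Matrix.diagonal (fun i => f (D i)) := by
    rw [← Matrix.map_mul, ← Matrix.map_mul, h, Matrix.diagonal_map (map_zero f)]
  have e1 : M.rank = (Matrix.diagonal D).rank := by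
    rw [← h, Matrix.rank_mul_eq_left_of_isUnit_det _ _ (by simp [hQ]),
      Matrix.rank_mul_eq_right_of_isUnit_det _ _ (by simp [hP])]
  have e2 : (M.map f).rank = (Matrix.diagonal (fun i => f (D i))).rank := by
    rw [← hf, Matrix.rank_mul_eq_left_of_isUnit_det _ _ (by simp [hQf]),
      Matrix.rank_mul_eq_right_of_isUnit_det _ _ (by simp [hPf])]
  rw [e1, e2, Matrix.rank_diagonal, Matrix.rank_diagonal]
  simp only [ne_eq, map_eq_zero]

/-! ### Square roots of positive definite real matrices -/

section Sqrt

variable {n : Type*} [Fintype n] [DecidableEq n] {M : Matrix n n ℝ}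

theorem Matrix.PosSemidef.sqrt_mul_sqrt (h : M.PosSemidef) :
    CFC.sqrt M * CFC.sqrt M = M :=
  CFC.sqrt_mul_sqrt_self M (Matrix.nonneg_iff_posSemidef.2 h)

theorem Matrix.transpose_cfcSqrt (M : Matrix n n ℝ) : (CFC.sqrt M).transpose = CFC.sqrt M := by
  have h := (Matrix.nonneg_iff_posSemidef.1 (CFC.sqrt_nonneg M)).isHermitian
  rwa [Matrix.IsHermitian, Matrix.conjTranspose_eq_transpose_of_trivial] at h

theorem Matrix.PosDef.isUnit_det_sqrt (h : M.PosDef) : IsUnit (CFC.sqrt M).det := by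
  have h1 : (CFC.sqrt M).det * (CFC.sqrt M).det = M.det := by
    rw [← Matrix.det_mul, h.posSemidef.sqrt_mul_sqrt]
  rw [isUnit_iff_ne_zero]
  intro h0
  rw [h0, zero_mul] at h1
  exact h.det_pos.ne h1

end Sqrt

namespace LagrangianSystem

variable {N : ℕ} (S : LagrangianSystem N)

theorem map_ofReal_mul (M M' : Matrix (Fin N) (Fin N) ℝ) :
    (M * M').map Complex.ofReal = M.map Complex.ofReal * M'.map Complex.ofReal :=
  Matrix.map_mul (f := Complex.ofRealHom)

theorem Kp_transpose : S.Kp.transpose = S.Kp := by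
  rw [Kp, Matrix.transpose_nonsing_inv, Matrix.transpose_cfcSqrt]

theorem Kq_transpose : S.Kq.transpose = S.Kq := Matrix.transpose_cfcSqrt _

theorem Kp_mul_sqrt : S.Kp * CFC.sqrt S.α = 1 :=
  Matrix.nonsing_inv_mul _ S.α_posDef.isUnit_det_sqrt

theorem sqrt_mul_Kp : CFC.sqrt S.α * S.Kp = 1 :=
  Matrix.mul_nonsing_inv _ S.α_posDef.isUnit_det_sqrt

/-- The damping matrix `2θ + βR`. -/
noncomputable def damping (β : ℝ) : Matrix (Fin N) (Fin N) ℝ := (2 : ℝ) • S.θ + β • S.R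

/-- The matrix of `A(β)`. -/
noncomputable def AMatrix (β : ℝ) : Matrix (Fin N ⊕ Fin N) (Fin N ⊕ Fin N) ℂ :=
  Matrix.fromBlocks ((-Complex.I) • (S.Kp * S.damping β * S.Kp).map Complex.ofReal)
    ((-Complex.I) • (S.Kp * S.Kq).map Complex.ofReal)
    (Complex.I • (S.Kq * S.Kp).map Complex.ofReal) 0

theorem OmegaMatrix_sub_smul_BMatrix (β : ℝ) :
    S.OmegaMatrix - (Complex.I * (β : ℂ)) • S.BMatrix = S.AMatrix β := by
  rw [OmegaMatrix, BMatrix, AMatrix, OmegaP, Phi, Matrix.fromBlocks_smul, sub_eq_add_neg,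
    Matrix.fromBlocks_neg, Matrix.fromBlocks_add]
  simp only [smul_zero, neg_zero, add_zero, Matrix.transpose_mul, Kp_transpose, Kq_transpose]
  congr 1
  ext i j
  simp only [damping, Matrix.mul_add, Matrix.add_mul, Matrix.mul_smul, Matrix.smul_mul,
    Matrix.neg_apply, Matrix.smul_apply, Matrix.map_apply, Matrix.add_apply, smul_eq_mul,
    Complex.ofReal_add, Complex.ofReal_mul, Complex.ofReal_ofNat]
  ring

theorem A_eq (β : ℝ) : S.A β = Matrix.toEuclideanLin (S.AMatrix β) := by
  rw [← OmegaMatrix_sub_smul_BMatrix, map_sub, map_smul]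
  rfl

theorem A_zero : S.A 0 = S.Omega := by simp [A]

theorem A_apply (β : ℝ) (x : StateSpace N) :
    S.A β x = S.Omega x - (Complex.I * (β : ℂ)) • S.B x := rfl

/-! #### Symmetry of `Ω` and `B` -/

theorem OmegaMatrix_isHermitian : S.OmegaMatrix.IsHermitian := by
  have h : S.OmegaMatrix = S.AMatrix 0 := by
    rw [← OmegaMatrix_sub_smul_BMatrix]; simp
  rw [h, AMatrix, Matrix.IsHermitian, Matrix.fromBlocks_conjTranspose]
  have hc : ∀ M : Matrix (Fin N) (Fin N) ℝ,
      (M.map Complex.ofReal).conjTranspose = M.transpose.map Complex.ofReal := by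
    intro M; ext i j; simp
  -- Without losses the upper left block is `-i` times a real skew matrix, hence Hermitian.
  have e0 : (S.Kp * S.damping 0 * S.Kp).transpose = -(S.Kp * S.damping 0 * S.Kp) := by
    simp [damping, Matrix.transpose_mul, Kp_transpose, S.θ_skew, Matrix.mul_assoc]
  simp only [Matrix.conjTranspose_smul, hc, e0, Matrix.transpose_mul, Kp_transpose, Kq_transpose,
    Matrix.conjTranspose_zero]
  congr 1 <;> ext i j <;> simp

theorem Omega_isSymmetric : S.Omega.IsSymmetric :=
  Matrix.isSymmetric_toEuclideanLin_iff.2 S.OmegaMatrix_isHermitian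

open scoped ComplexOrder in
theorem BMatrix_posSemidef : S.BMatrix.PosSemidef := by
  obtain ⟨C, hC⟩ := CStarAlgebra.nonneg_iff_eq_star_mul_self.1
    (Matrix.nonneg_iff_posSemidef.2 S.R_posSemidef)
  rw [Matrix.star_eq_conjTranspose] at hC
  have h : S.BMatrix = (Matrix.fromBlocks ((C * S.Kp).map Complex.ofReal) 0 0 0 :
      Matrix (Fin N ⊕ Fin N) (Fin N ⊕ Fin N) ℂ).conjTranspose *
      Matrix.fromBlocks ((C * S.Kp).map Complex.ofReal) 0 0 0 := by
    have hc : ((C * S.Kp).map Complex.ofReal).conjTranspose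
        = (C * S.Kp).transpose.map Complex.ofReal := by
      ext i j
      simp only [Matrix.conjTranspose_apply, Matrix.map_apply, Matrix.transpose_apply,
        RCLike.star_def, Complex.conj_ofReal]
    rw [Matrix.fromBlocks_conjTranspose, Matrix.fromBlocks_multiply, hc, BMatrix]
    simp only [Matrix.conjTranspose_zero, Matrix.mul_zero, add_zero, Matrix.zero_mul]
    congr 1
    rw [← map_ofReal_mul, hC, Matrix.conjTranspose_eq_transpose_of_trivial, Matrix.transpose_mul,
      Kp_transpose]
    simp only [Matrix.mul_assoc]
  rw [h]
  exact Matrix.posSemidef_conjTranspose_mul_self _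

open scoped ComplexOrder in
theorem B_isSymmetric : S.B.IsSymmetric :=
  Matrix.isSymmetric_toEuclideanLin_iff.2 S.BMatrix_posSemidef.isHermitian

open scoped ComplexOrder in
theorem B_re_inner_nonneg (x : StateSpace N) : 0 ≤ (inner ℂ x (S.B x)).re := by
  have := (Matrix.isPositive_toEuclideanLin_iff.2 S.BMatrix_posSemidef).re_inner_nonneg_right x
  exact this

/-- Each of `B` and the complexified `R` is a two-sided multiple of the other, by rectangular
matrices built from `K_p` and `√α` respectively; so their ranks agree. -/
theorem finrank_range_B : Module.finrank ℂ (LinearMap.range S.B) = S.R.rank := by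
  have h1 : Module.finrank ℂ (LinearMap.range S.B) = S.BMatrix.rank := by
    rw [Matrix.rank_eq_finrank_range_toLin S.BMatrix (EuclideanSpace.basisFun _ ℂ).toBasis
      (EuclideanSpace.basisFun _ ℂ).toBasis]
    rfl
  rw [h1]
  have h2 : S.BMatrix = (Matrix.fromRows (S.Kp.map Complex.ofReal) (0 : Matrix (Fin N) (Fin N) ℂ)) *
      (S.R.map Complex.ofReal) *
      (Matrix.fromCols (S.Kp.map Complex.ofReal) (0 : Matrix (Fin N) (Fin N) ℂ)) := by
    rw [Matrix.fromRows_mul, Matrix.fromRows_mul_fromCols, BMatrix, Kp_transpose,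
      map_ofReal_mul, map_ofReal_mul]
    simp
  have h3 : S.R.map Complex.ofReal =
      (Matrix.fromCols ((CFC.sqrt S.α).map Complex.ofReal) (0 : Matrix (Fin N) (Fin N) ℂ)) *
      S.BMatrix *
      (Matrix.fromRows ((CFC.sqrt S.α).map Complex.ofReal) (0 : Matrix (Fin N) (Fin N) ℂ)) := by
    have e : CFC.sqrt S.α * (S.Kp * S.R * S.Kp) * CFC.sqrt S.α = S.R := by
      rw [Matrix.mul_assoc S.Kp, ← Matrix.mul_assoc (CFC.sqrt S.α), sqrt_mul_Kp, Matrix.one_mul,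
        Matrix.mul_assoc, Kp_mul_sqrt, Matrix.mul_one]
    rw [BMatrix, Matrix.fromCols_mul_fromBlocks, Matrix.fromCols_mul_fromRows, Kp_transpose]
    simp only [Matrix.mul_zero, add_zero, ← map_ofReal_mul, e]
  have h4 : (S.R.map Complex.ofReal).rank = S.R.rank := Matrix.rank_map_field Complex.ofRealHom S.R
  apply le_antisymm
  · rw [h2, ← h4]
    exact (Matrix.rank_mul_le_left _ _).trans (Matrix.rank_mul_le_right _ _)
  · rw [← h4, h3]
    exact (Matrix.rank_mul_le_left _ _).trans (Matrix.rank_mul_le_right _ _)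

theorem finrank_ker_B : Module.finrank ℂ (LinearMap.ker S.B) + S.R.rank = 2 * N := by
  have := LinearMap.finrank_range_add_finrank_ker S.B
  rw [finrank_range_B] at this
  simp at this
  omega

/-! #### Conjugation symmetry -/

/-- Entrywise complex conjugation on the state space. -/
def conjState (x : StateSpace N) : StateSpace N := WithLp.toLp 2 (star (WithLp.ofLp x))

theorem conjState_eq_zero {x : StateSpace N} : conjState x = 0 ↔ x = 0 := by
  constructor
  · intro h
    ext i
    have := congrArg (fun y : StateSpace N => y i) h
    simpa [conjState] using this
  · rintro rfl
    ext i
    simp [conjState]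

/-- The matrix of `A(β)` has purely imaginary entries. -/
theorem A_conjState (β : ℝ) (x : StateSpace N) : S.A β (conjState x) = -conjState (S.A β x) := by
  have hA : (S.AMatrix β).map star = -S.AMatrix β := by
    rw [AMatrix]
    ext (i | i) (j | j) <;> simp
  ext i
  rw [A_eq, Matrix.toLpLin_apply, Matrix.toLpLin_apply]
  simp only [conjState, PiLp.neg_apply, Pi.star_apply, Matrix.mulVec, dotProduct, star_sum,
    star_mul', ← Finset.sum_neg_distrib]
  refine Finset.sum_congr rfl fun j _ => ?_
  have := congrFun (congrFun hA i) j
  simp only [Matrix.map_apply, Matrix.neg_apply] at this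
  rw [this]
  ring

theorem conjState_smul (c : ℂ) (x : StateSpace N) :
    conjState (c • x) = (starRingEnd ℂ c) • conjState x := by
  ext i; simp [conjState]

theorem neg_conj_mem_spectrum {β : ℝ} {ζ : ℂ} (h : ζ ∈ spectrum ℂ (S.A β)) :
    -(starRingEnd ℂ ζ) ∈ spectrum ℂ (S.A β) := by
  obtain ⟨w, h0, hw⟩ := mem_spectrum_iff_exists_eigenvector.1 h
  refine mem_spectrum_iff_exists_eigenvector.2 ⟨conjState w, mt conjState_eq_zero.1 h0, ?_⟩
  rw [A_conjState, hw, conjState_smul, neg_smul]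

/-! #### Duality -/

/-- Exchange of the two components of the state space. -/
noncomputable def swap : StateSpace N ≃ₗ[ℂ] StateSpace N :=
  (LinearIsometryEquiv.piLpCongrLeft 2 ℂ ℂ (Equiv.sumComm (Fin N) (Fin N))).toLinearEquiv

theorem swap_apply (x : StateSpace N) (i : Fin N ⊕ Fin N) : swap x i = x i.swap := rfl

theorem swap_swap (x : StateSpace N) : swap (swap x) = x := by
  ext i; simp [swap_apply]

/-- The heart of the duality: the dual matrix is conjugate, by exchange of components, to `-A(β)⁻¹`.
The two damping terms cancel and the off-diagonal blocks are mutually inverse. -/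
theorem AMatrix_mul_swap_mul_dual_AMatrix (h : S.η.PosDef) (β : ℝ) :
    S.AMatrix β * (Matrix.fromBlocks 0 1 1 0 * (S.dual h).AMatrix β)
      = -Matrix.fromBlocks 0 1 1 0 := by
  have e1 : (S.dual h).Kp = S.Kq⁻¹ := rfl
  have e2 : (S.dual h).Kq = CFC.sqrt S.α := rfl
  have e3 : (S.dual h).damping β = S.damping β := rfl
  have u : IsUnit S.Kq.det := h.isUnit_det_sqrt
  rw [AMatrix, AMatrix, Matrix.fromBlocks_multiply, Matrix.fromBlocks_multiply,
    Matrix.fromBlocks_neg, e1, e2, e3]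
  simp only [Matrix.zero_mul, Matrix.one_mul, zero_add, add_zero, Matrix.mul_zero, Matrix.smul_mul,
    Matrix.mul_smul, smul_zero, smul_smul, ← map_ofReal_mul]
  have f1 : S.Kp * S.damping β * S.Kp * (CFC.sqrt S.α * S.Kq⁻¹)
      = S.Kp * S.damping β * S.Kq⁻¹ := by
    rw [Matrix.mul_assoc, ← Matrix.mul_assoc S.Kp (CFC.sqrt S.α), Kp_mul_sqrt, Matrix.one_mul]
  have f2 : S.Kp * S.Kq * (S.Kq⁻¹ * S.damping β * S.Kq⁻¹) = S.Kp * S.damping β * S.Kq⁻¹ := by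
    rw [Matrix.mul_assoc S.Kq⁻¹, ← Matrix.mul_assoc, Matrix.mul_assoc S.Kp,
      Matrix.mul_nonsing_inv _ u, Matrix.mul_one, Matrix.mul_assoc]
  have f3 : S.Kp * S.Kq * (S.Kq⁻¹ * CFC.sqrt S.α) = 1 := by
    rw [← Matrix.mul_assoc, Matrix.mul_assoc S.Kp, Matrix.mul_nonsing_inv _ u, Matrix.mul_one,
      Kp_mul_sqrt]
  have f4 : S.Kq * S.Kp * (CFC.sqrt S.α * S.Kq⁻¹) = 1 := by
    rw [← Matrix.mul_assoc, Matrix.mul_assoc S.Kq, Kp_mul_sqrt, Matrix.mul_one,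
      Matrix.mul_nonsing_inv _ u]
  rw [f1, f2, f3, f4]
  have one : (1 : Matrix (Fin N) (Fin N) ℝ).map Complex.ofReal = 1 :=
    Matrix.map_one _ Complex.ofReal_zero Complex.ofReal_one
  simp [one]

theorem A_swap_dual_A (h : S.η.PosDef) (β : ℝ) (x : StateSpace N) :
    S.A β (swap ((S.dual h).A β x)) = -swap x := by
  have hs : ∀ y : StateSpace N, swap y = Matrix.toEuclideanLin
      (Matrix.fromBlocks 0 1 1 0 : Matrix (Fin N ⊕ Fin N) (Fin N ⊕ Fin N) ℂ) y := by
    intro y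
    ext (i | i)
    all_goals simp [swap_apply, Matrix.toLpLin_apply, Matrix.mulVec, dotProduct, Matrix.one_apply]
  rw [hs, hs, A_eq, A_eq]
  simp only [Matrix.toLpLin_apply, Matrix.mulVec_mulVec, AMatrix_mul_swap_mul_dual_AMatrix,
    Matrix.neg_mulVec]
  rfl

/-- The bidual system is definitionally `S`, so each duality statement can be applied to `S.dual h`
and read backwards. -/
theorem dual_A_swap_A (h : S.η.PosDef) (β : ℝ) (x : StateSpace N) :
    (S.dual h).A β (swap (S.A β x)) = -swap x :=
  (S.dual h).A_swap_dual_A S.α_posDef β x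

theorem zero_notMem_spectrum_A (h : S.η.PosDef) (β : ℝ) : (0 : ℂ) ∉ spectrum ℂ (S.A β) := by
  intro h0
  obtain ⟨w, hw0, hw⟩ := mem_spectrum_iff_exists_eigenvector.1 h0
  have := S.dual_A_swap_A h β w
  rw [hw, zero_smul, map_zero, map_zero, eq_comm, neg_eq_zero, LinearEquiv.map_eq_zero_iff] at this
  exact hw0 this

theorem dual_A_swap_of_eigenvector (h : S.η.PosDef) {β : ℝ} {ζ : ℂ} {w : StateSpace N}
    (hw0 : w ≠ 0) (hw : S.A β w = ζ • w) :
    (S.dual h).A β (swap w) = (-ζ⁻¹) • swap w := by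
  have hζ : ζ ≠ 0 := by
    rintro rfl
    exact S.zero_notMem_spectrum_A h β (mem_spectrum_iff_exists_eigenvector.2 ⟨w, hw0, hw⟩)
  have := S.dual_A_swap_A h β w
  rw [hw, map_smul, map_smul] at this
  rw [neg_smul, ← smul_neg, ← this, smul_smul, inv_mul_cancel₀ hζ, one_smul]

theorem neg_inv_mem_spectrum_dual (h : S.η.PosDef) {β : ℝ} {ζ : ℂ}
    (hζ : ζ ∈ spectrum ℂ (S.A β)) : -ζ⁻¹ ∈ spectrum ℂ ((S.dual h).A β) := by
  obtain ⟨w, hw0, hw⟩ := mem_spectrum_iff_exists_eigenvector.1 hζ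
  exact mem_spectrum_iff_exists_eigenvector.2
    ⟨swap w, by simpa using hw0, S.dual_A_swap_of_eigenvector h hw0 hw⟩

end LagrangianSystem

/-! ### Extrema over finite real spectra, and a scalar inequality. -/

theorem finite_setOf_ofReal_mem_spectrum {V : Type*} [AddCommGroup V] [Module ℂ V]
    [FiniteDimensional ℂ V] (T : Module.End ℂ V) : {μ : ℝ | (μ : ℂ) ∈ spectrum ℂ T}.Finite :=
  (Module.End.finite_spectrum T).preimage Complex.ofReal_injective.injOn

theorem isLeast_sInf_of_subset_finite {s t : Set ℝ} (hs : s.Nonempty) (ht : t.Finite)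
    (hst : s ⊆ t) : IsLeast s (sInf s) :=
  ⟨hs.csInf_mem (ht.subset hst), fun _ h => csInf_le (ht.subset hst).bddBelow h⟩

/-- The scalar inequality behind the Stein condition for a perturbation of an operator that
vanishes on one subspace and is bounded below by `2 s` on its complement. -/
theorem sq_sub_sq_lt_of_perturbation {s a b p q r : ℝ} (hs : 0 ≤ s) (ha : 0 ≤ a)
    (h1 : 2 * s * a - q ≤ p) (h2 : r ^ 2 + q ^ 2 < s ^ 2 * (b ^ 2 + a ^ 2)) :
    r ^ 2 - p ^ 2 < s ^ 2 * (b ^ 2 - a ^ 2) := by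
  have h3 : (2 * s * a) ^ 2 ≤ (p + q) ^ 2 := pow_le_pow_left₀ (by positivity) (by linarith) 2
  -- From `(p + q)² ≤ 2 p² + 2 q²` one gets `2 s² a² ≤ p² + q²`; subtract this from `h2`.
  nlinarith [sq_nonneg (p - q)]

namespace LagrangianSystem

variable {N : ℕ} (S : LagrangianSystem N)

theorem pos_dim (S : LagrangianSystem N) : 0 < N :=
  S.R_rank_pos.trans_le (by simpa using Matrix.rank_le_card_width S.R)

theorem nontrivial_stateSpace (S : LagrangianSystem N) : Nontrivial (StateSpace N) := by
  have := S.pos_dim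
  have : Nonempty (Fin N) := ⟨⟨0, this⟩⟩
  infer_instance

/-! #### The extreme eigenvalues -/

theorem neg_mem_spectrum_Omega {μ : ℝ} (h : (μ : ℂ) ∈ spectrum ℂ S.Omega) :
    ((-μ : ℝ) : ℂ) ∈ spectrum ℂ S.Omega := by
  rw [← A_zero] at h ⊢
  simpa using S.neg_conj_mem_spectrum h

theorem abs_mem_spectrum_Omega {μ : ℝ} (h : (μ : ℂ) ∈ spectrum ℂ S.Omega) :
    ((|μ| : ℝ) : ℂ) ∈ spectrum ℂ S.Omega := by
  rcases abs_choice μ with h1 | h1 <;> rw [h1]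
  exacts [h, S.neg_mem_spectrum_Omega h]

theorem zero_notMem_spectrum_Omega (h : S.η.PosDef) : (0 : ℂ) ∉ spectrum ℂ S.Omega := by
  rw [← A_zero]
  exact S.zero_notMem_spectrum_A h 0

theorem exists_real_mem_spectrum_Omega : ∃ μ : ℝ, (μ : ℂ) ∈ spectrum ℂ S.Omega := by
  have := S.nontrivial_stateSpace
  obtain ⟨ζ, hζ⟩ := Module.End.exists_eigenvalue S.Omega
  have hζ' := Module.End.hasEigenvalue_iff_mem_spectrum.1 hζ
  exact ⟨ζ.re, by rwa [S.Omega_isSymmetric.ofReal_re_eq_of_mem_spectrum hζ']⟩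

theorem isGreatest_omegaMax : IsGreatest {ω : ℝ | (ω : ℂ) ∈ spectrum ℂ S.Omega} S.omegaMax :=
  have hf := finite_setOf_ofReal_mem_spectrum S.Omega
  ⟨Set.Nonempty.csSup_mem S.exists_real_mem_spectrum_Omega hf, fun _ h => le_csSup hf.bddAbove h⟩

theorem abs_le_omegaMax {μ : ℝ} (h : (μ : ℂ) ∈ spectrum ℂ S.Omega) : |μ| ≤ S.omegaMax :=
  S.isGreatest_omegaMax.2 (S.abs_mem_spectrum_Omega h)

theorem isLeast_omegaMin (h : S.η.PosDef) :
    IsLeast {ω : ℝ | 0 < ω ∧ (ω : ℂ) ∈ spectrum ℂ S.Omega} S.omegaMin := by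
  refine isLeast_sInf_of_subset_finite ?_ (finite_setOf_ofReal_mem_spectrum S.Omega)
    fun _ hω => hω.2
  obtain ⟨μ, hμ⟩ := S.exists_real_mem_spectrum_Omega
  refine ⟨|μ|, abs_pos.2 ?_, S.abs_mem_spectrum_Omega hμ⟩
  rintro rfl
  exact S.zero_notMem_spectrum_Omega h (by simpa using hμ)

theorem omegaMin_pos (h : S.η.PosDef) : 0 < S.omegaMin := (S.isLeast_omegaMin h).1.1

theorem omegaMin_le_omegaMax (h : S.η.PosDef) : S.omegaMin ≤ S.omegaMax :=
  S.isGreatest_omegaMax.2 (S.isLeast_omegaMin h).1.2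

theorem omegaMax_pos (h : S.η.PosDef) : 0 < S.omegaMax :=
  (S.omegaMin_pos h).trans_le (S.omegaMin_le_omegaMax h)

theorem inv_mem_spectrum_dual_Omega (h : S.η.PosDef) {μ : ℝ}
    (hμ : (μ : ℂ) ∈ spectrum ℂ S.Omega) : ((μ⁻¹ : ℝ) : ℂ) ∈ spectrum ℂ (S.dual h).Omega := by
  rw [← neg_neg μ⁻¹]
  apply neg_mem_spectrum_Omega
  rw [← A_zero] at hμ ⊢
  simpa using S.neg_inv_mem_spectrum_dual h hμ

/-- At `β = 0` duality sends `μ` to `-μ⁻¹`, and the spectrum of `Ω` is symmetric, so inversion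
exchanges the extreme positive eigenvalues. -/
theorem dual_omegaMax (h : S.η.PosDef) : (S.dual h).omegaMax = S.omegaMin⁻¹ := by
  have h0 := (S.dual h).omegaMax_pos S.α_posDef
  apply le_antisymm
  · rw [le_inv_comm₀ h0 (S.omegaMin_pos h)]
    exact (S.isLeast_omegaMin h).2 ⟨inv_pos.2 h0,
      (S.dual h).inv_mem_spectrum_dual_Omega S.α_posDef (S.dual h).isGreatest_omegaMax.1⟩
  · exact (S.dual h).isGreatest_omegaMax.2
      (S.inv_mem_spectrum_dual_Omega h (S.isLeast_omegaMin h).1.2)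

theorem dual_omegaMin (h : S.η.PosDef) : (S.dual h).omegaMin = S.omegaMax⁻¹ := by
  rw [← inv_inv (S.dual h).omegaMin, ← (S.dual h).dual_omegaMax S.α_posDef]
  rfl

theorem norm_Omega_le (h : S.η.PosDef) (x : StateSpace N) : ‖S.Omega x‖ ≤ S.omegaMax * ‖x‖ :=
  S.Omega_isSymmetric.norm_apply_le (S.omegaMax_pos h).le (fun _ hμ => S.abs_le_omegaMax hμ) x

theorem nonneg_of_mem_spectrum_B {b : ℝ} (hb : (b : ℂ) ∈ spectrum ℂ S.B) : 0 ≤ b := by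
  obtain ⟨w, hw0, hw⟩ := mem_spectrum_iff_exists_eigenvector.1 hb
  have h1 := S.B_re_inner_nonneg w
  rw [hw, inner_smul_right, inner_self_eq_norm_sq_to_K] at h1
  have h2 : ((b : ℂ) * ((‖w‖ : ℂ)) ^ 2).re = b * ‖w‖ ^ 2 := by norm_cast
  have h3 : 0 ≤ b * ‖w‖ ^ 2 := by rw [← h2]; exact h1
  exact nonneg_of_mul_nonneg_left h3 (by positivity)

theorem isLeast_bMin : IsLeast {b : ℝ | b ≠ 0 ∧ (b : ℂ) ∈ spectrum ℂ S.B} S.bMin := by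
  refine isLeast_sInf_of_subset_finite ?_ (finite_setOf_ofReal_mem_spectrum S.B) fun _ hb => hb.2
  by_contra hne
  have h0 : ∀ μ : ℝ, (μ : ℂ) ∈ spectrum ℂ S.B → |μ| ≤ 0 := by
    intro μ hμ
    by_contra hμ0
    exact hne ⟨μ, by simpa using hμ0, hμ⟩
  have hB : S.B = 0 := by
    ext1 x
    simpa using S.B_isSymmetric.norm_apply_le le_rfl h0 x
  have h1 := S.finrank_range_B
  rw [hB, LinearMap.range_zero, finrank_bot] at h1
  exact S.R_rank_pos.ne h1

theorem bMin_pos : 0 < S.bMin :=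
  (S.nonneg_of_mem_spectrum_B S.isLeast_bMin.1.2).lt_of_ne' S.isLeast_bMin.1.1

theorem bMin_mul_norm_le {x : StateSpace N} (hx : x ∈ (LinearMap.ker S.B)ᗮ) :
    S.bMin * ‖x‖ ≤ ‖S.B x‖ :=
  S.B_isSymmetric.le_norm_apply S.bMin_pos.le (fun _ hμ hμ0 =>
    (S.isLeast_bMin.2 ⟨hμ0, hμ⟩).trans (le_abs_self _)) hx

/-- Dissipativity: the imaginary part of `⟨w, A w⟩` is `-β ⟨w, B w⟩`. -/
theorem im_nonpos_of_mem_spectrum {β : ℝ} (hβ : 0 ≤ β) {ζ : ℂ} (hζ : ζ ∈ spectrum ℂ (S.A β)) :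
    ζ.im ≤ 0 := by
  obtain ⟨w, hw0, hw⟩ := mem_spectrum_iff_exists_eigenvector.1 hζ
  have h1 := congrArg (fun y => (inner ℂ w y).im) hw
  simp only [A_apply, inner_sub_right, inner_smul_right, inner_self_eq_norm_sq_to_K] at h1
  have h2 : (inner ℂ w (S.Omega w)).im = 0 := by
    rw [← Complex.conj_eq_iff_im, inner_conj_symm]
    exact S.Omega_isSymmetric w w
  have h3 : (ζ * ((‖w‖ : ℂ)) ^ 2).im = ζ.im * ‖w‖ ^ 2 := by
    rw [← Complex.ofReal_pow, Complex.im_mul_ofReal]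
  have h4 : (Complex.I * (β : ℂ) * inner ℂ w (S.B w)).im = β * (inner ℂ w (S.B w)).re := by
    simp [mul_assoc]
  have h5 : -(β * (inner ℂ w (S.B w)).re) = ζ.im * ‖w‖ ^ 2 := by
    rw [← h3, ← h4]
    have := h1
    rw [Complex.sub_im, h2, zero_sub] at this
    exact this
  have h6 := mul_nonneg hβ (S.B_re_inner_nonneg w)
  have h7 : 0 < ‖w‖ ^ 2 := by positivity
  by_contra! h8
  have := mul_pos h8 h7
  linarith

/-! #### The first splitting -/

section First

variable {S} {β : ℝ}

theorem pos_of_lt (h : S.η.PosDef) (hβ : 2 * S.omegaMax / S.bMin < β) : 0 < β :=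
  (div_pos (mul_pos two_pos (S.omegaMax_pos h)) S.bMin_pos).trans hβ

theorem two_mul_omegaMax_lt (hβ : 2 * S.omegaMax / S.bMin < β) :
    2 * S.omegaMax < β * S.bMin := (div_lt_iff₀ S.bMin_pos).1 hβ

/-- The eigenvalue equation reads `iβ (B - iζ/β) w = Ω w`, so `iζ/β` lies within `ω_max / β` of an
eigenvalue `b` of `B`; multiply by `β`. The case `b = 0` gives `σ₀`. -/
theorem spectrum_A_eq_union (h : S.η.PosDef) (hβ : 2 * S.omegaMax / S.bMin < β) :
    spectrum ℂ (S.A β) = S.sigma0 β ∪ S.sigma1 β := by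
  have hβ0 := pos_of_lt h hβ
  refine Set.Subset.antisymm (fun ζ hζ => ?_) (Set.union_subset Set.inter_subset_left
    Set.inter_subset_left)
  obtain ⟨w, hw0, hw⟩ := mem_spectrum_iff_exists_eigenvector.1 hζ
  have hβ' : (β : ℂ) ≠ 0 := by exact_mod_cast hβ0.ne'
  have h1 : (Complex.I * (β : ℂ)) • (S.B w - (Complex.I * ζ / β) • w) = S.Omega w := by
    rw [smul_sub, smul_smul]
    have : Complex.I * (β : ℂ) * (Complex.I * ζ / β) = -ζ := by
      field_simp
      linear_combination ζ * Complex.I_sq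
    rw [this, neg_smul, ← hw, A_apply]
    abel
  have h2 : ‖S.B w - (Complex.I * ζ / β) • w‖ ≤ S.omegaMax / β * ‖w‖ := by
    have h3 := S.norm_Omega_le h w
    rw [← h1, norm_smul, norm_mul, Complex.norm_I, one_mul, Complex.norm_real,
      Real.norm_of_nonneg hβ0.le] at h3
    rw [div_mul_eq_mul_div, le_div_iff₀ hβ0]
    linarith
  obtain ⟨b, hb, hbζ⟩ := S.B_isSymmetric.exists_eigenvalue_near hw0 h2
  have h4 : ‖ζ - -(Complex.I * β * b)‖ ≤ S.omegaMax := by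
    have : Complex.I * ζ / β - b = Complex.I / β * (ζ - -(Complex.I * β * b)) := by
      field_simp
      linear_combination (-(β * b) : ℂ) * Complex.I_sq
    rw [this, norm_mul, norm_div, Complex.norm_I, Complex.norm_real, Real.norm_of_nonneg hβ0.le,
      div_mul_eq_mul_div, one_mul, div_le_div_iff_of_pos_right hβ0] at hbζ
    exact hbζ
  by_cases hb0 : b = 0
  · left
    refine ⟨hζ, ?_⟩
    simpa [hb0] using h4
  · right
    refine ⟨hζ, Set.mem_biUnion (x := b) ⟨hb0, hb⟩ ?_⟩
    rwa [mem_closedBall_iff_norm]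

theorem norm_le_of_mem_sigma0 {ζ : ℂ} (hζ : ζ ∈ S.sigma0 β) : ‖ζ‖ ≤ S.omegaMax := by
  simpa using hζ.2

theorem le_norm_of_mem_sigma1 (hβ0 : 0 < β) {ζ : ℂ} (hζ : ζ ∈ S.sigma1 β) :
    β * S.bMin - S.omegaMax ≤ ‖ζ‖ := by
  obtain ⟨b, hb, hζb⟩ := Set.mem_iUnion₂.1 hζ.2
  rw [mem_closedBall_iff_norm] at hζb
  have h1 : ‖Complex.I * (β : ℂ) * b‖ = β * b := by
    rw [norm_mul, norm_mul, Complex.norm_I, Complex.norm_real, Complex.norm_real,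
      Real.norm_of_nonneg hβ0.le, Real.norm_of_nonneg (S.nonneg_of_mem_spectrum_B hb.2), one_mul]
  have h2 : ‖Complex.I * (β : ℂ) * b‖ ≤ ‖ζ - -(Complex.I * β * b)‖ + ‖ζ‖ := by
    refine le_trans (le_of_eq ?_) (norm_sub_le _ _)
    congr 1; ring
  have h3 : β * S.bMin ≤ β * b := by gcongr; exact S.isLeast_bMin.2 hb
  linarith

/-- The radius `β b_min / 2` exceeds `ω_max`, so it separates the two parts of the spectrum and
serves as `s` in the Stein criterion. -/
theorem half_lt_norm_of_mem_sigma1 (hβ0 : 0 < β) (hβ : 2 * S.omegaMax / S.bMin < β) {ζ : ℂ}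
    (hζ : ζ ∈ S.sigma1 β) : β * S.bMin / 2 < ‖ζ‖ := by
  have h1 := two_mul_omegaMax_lt hβ
  have h2 := le_norm_of_mem_sigma1 hβ0 hζ
  linarith

theorem disjoint_sigma (h : S.η.PosDef) (hβ : 2 * S.omegaMax / S.bMin < β) :
    Disjoint (S.sigma0 β) (S.sigma1 β) := by
  rw [Set.disjoint_left]
  intro ζ h0 h1
  have h2 := half_lt_norm_of_mem_sigma1 (pos_of_lt h hβ) hβ h1
  have h3 := norm_le_of_mem_sigma0 h0
  have h4 := two_mul_omegaMax_lt hβ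
  linarith

/-! ### The form that separates high-loss from low-loss states. -/

variable (S) in
/-- The indefinite form `‖P x‖² - ‖(1 - P) x‖²`, `P` the orthogonal projection onto `Ker B`. -/
noncomputable def lossForm (x : StateSpace N) : ℝ :=
  ‖(LinearMap.ker S.B).starProjection x‖ ^ 2 - ‖(LinearMap.ker S.B)ᗮ.starProjection x‖ ^ 2

theorem continuous_lossForm : Continuous S.lossForm := by unfold lossForm; fun_prop

theorem lossForm_smul (c : ℂ) (x : StateSpace N) :
    S.lossForm (c • x) = ‖c‖ ^ 2 * S.lossForm x := by
  simp only [lossForm, map_smul, norm_smul]; ring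

theorem B_starProjection_orthogonal (x : StateSpace N) :
    S.B ((LinearMap.ker S.B)ᗮ.starProjection x) = S.B x := by
  have h := (LinearMap.ker S.B).starProjection_add_starProjection_orthogonal x
  conv_rhs => rw [← h, map_add]
  rw [LinearMap.mem_ker.1 ((LinearMap.ker S.B).starProjection_apply_mem x), zero_add]

theorem B_mem_orthogonal (x : StateSpace N) : S.B x ∈ (LinearMap.ker S.B)ᗮ := by
  intro y hy
  rw [← S.B_isSymmetric y x, LinearMap.mem_ker.1 hy, inner_zero_left]

theorem starProjection_A (x : StateSpace N) : (LinearMap.ker S.B).starProjection (S.A β x)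
    = (LinearMap.ker S.B).starProjection (S.Omega x) := by
  rw [A_apply, map_sub, map_smul,
    (Submodule.starProjection_apply_eq_zero_iff _).2 (B_mem_orthogonal x), smul_zero, sub_zero]

theorem starProjection_orthogonal_A (x : StateSpace N) :
    (LinearMap.ker S.B)ᗮ.starProjection (S.A β x)
    = (LinearMap.ker S.B)ᗮ.starProjection (S.Omega x) - (Complex.I * (β : ℂ)) • S.B x := by
  rw [A_apply, map_sub, map_smul,
    Submodule.starProjection_eq_self_iff.2 (B_mem_orthogonal x)]

theorem le_norm_smul_B (hβ0 : 0 < β) (x : StateSpace N) :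
    β * S.bMin * ‖(LinearMap.ker S.B)ᗮ.starProjection x‖ ≤ ‖(Complex.I * (β : ℂ)) • S.B x‖ := by
  rw [norm_smul, norm_mul, Complex.norm_I, one_mul, Complex.norm_real,
    Real.norm_of_nonneg hβ0.le, mul_assoc, ← B_starProjection_orthogonal]
  gcongr
  exact S.bMin_mul_norm_le (Submodule.starProjection_apply_mem _ x)

/-- `-iβB` vanishes on `Ker B` and is bounded below by `β b_min = 2s` on the complement, while `‖Ωx‖
≤ ω_max ‖x‖ < s ‖x‖`; this is the setting of `sq_sub_sq_lt_of_perturbation`. -/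
theorem lossForm_A_lt (h : S.η.PosDef) (hβ : 2 * S.omegaMax / S.bMin < β) {x : StateSpace N}
    (hx : x ≠ 0) : S.lossForm (S.A β x) < (β * S.bMin / 2) ^ 2 * S.lossForm x := by
  have hβ0 := pos_of_lt h hβ
  have hs := two_mul_omegaMax_lt hβ
  have hω := S.omegaMax_pos h
  have hx' : 0 < ‖x‖ := norm_pos_iff.2 hx
  refine sq_sub_sq_lt_of_perturbation
    (q := ‖(LinearMap.ker S.B)ᗮ.starProjection (S.Omega x)‖) (by linarith) (norm_nonneg _) ?_ ?_
  · rw [starProjection_orthogonal_A]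
    have h1 := le_norm_smul_B (S := S) hβ0 x
    have h2 := norm_sub_norm_le ((Complex.I * (β : ℂ)) • S.B x)
      ((LinearMap.ker S.B)ᗮ.starProjection (S.Omega x))
    rw [norm_sub_rev] at h2
    linarith
  · rw [starProjection_A, ← Submodule.norm_sq_eq_add_norm_sq_starProjection,
      ← Submodule.norm_sq_eq_add_norm_sq_starProjection, ← mul_pow]
    refine pow_lt_pow_left₀ ((S.norm_Omega_le h x).trans_lt ?_) (norm_nonneg _) two_ne_zero
    gcongr
    linarith

theorem Hll_invariant : ∀ w ∈ S.Hll β, S.A β w ∈ S.Hll β := spectralSubspace_invariant _ _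

theorem Hhl_invariant : ∀ w ∈ S.Hhl β, S.A β w ∈ S.Hhl β := spectralSubspace_invariant _ _

theorem restrictedSpectrum_Hll : restrictedSpectrum (S.A β) (S.Hll β) = S.sigma0 β :=
  restrictedSpectrum_spectralSubspace _ Set.inter_subset_left

theorem restrictedSpectrum_Hhl : restrictedSpectrum (S.A β) (S.Hhl β) = S.sigma1 β :=
  restrictedSpectrum_spectralSubspace _ Set.inter_subset_left

theorem lossForm_pos_of_mem_Hll (h : S.η.PosDef) (hβ : 2 * S.omegaMax / S.bMin < β)
    {x : StateSpace N} (hx : x ∈ S.Hll β) (hx0 : x ≠ 0) : 0 < S.lossForm x := by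
  have hs := two_mul_omegaMax_lt hβ
  have hω := S.omegaMax_pos h
  refine pos_of_stein ((S.A β).restrict Hll_invariant : Module.End ℂ (S.Hll β))
    (s := β * S.bMin / 2) (by linarith) ?_ (f := fun y => S.lossForm y)
    (continuous_lossForm.comp continuous_subtype_val) (fun c y => lossForm_smul c _)
    (fun y hy => lossForm_A_lt h hβ (by simpa using hy)) (x := ⟨x, hx⟩) (by simpa using hx0)
  intro ζ hζ
  rw [← restrictedSpectrum_eq_spectrum, restrictedSpectrum_Hll] at hζ
  have := norm_le_of_mem_sigma0 hζ
  linarith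

theorem lossForm_neg_of_mem_Hhl (h : S.η.PosDef) (hβ : 2 * S.omegaMax / S.bMin < β)
    {x : StateSpace N} (hx : x ∈ S.Hhl β) (hx0 : x ≠ 0) : S.lossForm x < 0 := by
  have hs := two_mul_omegaMax_lt hβ
  have hω := S.omegaMax_pos h
  refine neg_of_stein ((S.A β).restrict Hhl_invariant : Module.End ℂ (S.Hhl β))
    (s := β * S.bMin / 2) (by linarith) ?_ (f := fun y => S.lossForm y)
    (continuous_lossForm.comp continuous_subtype_val) (fun c y => lossForm_smul c _)
    (fun y hy => lossForm_A_lt h hβ (by simpa using hy)) (x := ⟨x, hx⟩) (by simpa using hx0)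
  intro ζ hζ
  rw [← restrictedSpectrum_eq_spectrum, restrictedSpectrum_Hhl] at hζ
  exact half_lt_norm_of_mem_sigma1 (pos_of_lt h hβ) hβ hζ

theorem isCompl_Hhl_Hll (h : S.η.PosDef) (hβ : 2 * S.omegaMax / S.bMin < β) :
    IsCompl (S.Hhl β) (S.Hll β) := by
  refine ⟨disjoint_spectralSubspace _ (disjoint_sigma h hβ).symm, codisjoint_iff.2 ?_⟩
  rw [Hhl, Hll, ← spectralSubspace_union, Set.union_comm, ← spectrum_A_eq_union h hβ,
    spectralSubspace_spectrum]

theorem finrank_stateSpace : Module.finrank ℂ (StateSpace N) = 2 * N := by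
  simp; omega

/-- The signs of the form make the low-loss space disjoint from `(Ker B)ᗮ` and the high-loss space
disjoint from `Ker B`. The two resulting upper bounds add up to `2N`, so both are equalities. -/
theorem finrank_Hhl_and_Hll (h : S.η.PosDef) (hβ : 2 * S.omegaMax / S.bMin < β) :
    Module.finrank ℂ (S.Hhl β) = S.R.rank ∧ Module.finrank ℂ (S.Hll β) + S.R.rank = 2 * N := by
  have h1 : Disjoint (S.Hll β) (LinearMap.ker S.B)ᗮ := by
    rw [Submodule.disjoint_def]
    intro x hx hx2
    by_contra hx0
    have := lossForm_pos_of_mem_Hll h hβ hx hx0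
    rw [lossForm, (Submodule.starProjection_apply_eq_zero_iff _).2 hx2, norm_zero] at this
    nlinarith [sq_nonneg ‖(LinearMap.ker S.B)ᗮ.starProjection x‖]
  have h2 : Disjoint (S.Hhl β) (LinearMap.ker S.B) := by
    rw [Submodule.disjoint_def]
    intro x hx hx2
    by_contra hx0
    have := lossForm_neg_of_mem_Hhl h hβ hx hx0
    rw [lossForm, (Submodule.starProjection_apply_eq_zero_iff _).2
      (Submodule.le_orthogonal_orthogonal _ hx2), norm_zero] at this
    nlinarith [sq_nonneg ‖(LinearMap.ker S.B).starProjection x‖]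
  have e1 := Submodule.finrank_add_finrank_le_of_disjoint h1
  have e2 := Submodule.finrank_add_finrank_le_of_disjoint h2
  have e3 := Submodule.finrank_add_finrank_orthogonal (LinearMap.ker S.B)
  have e4 := Submodule.finrank_add_eq_of_isCompl (isCompl_Hhl_Hll h hβ)
  have e5 := S.finrank_ker_B
  rw [finrank_stateSpace] at e1 e2 e3 e4
  omega

theorem modalDichotomyI (h : S.η.PosDef) (hβ : 2 * S.omegaMax / S.bMin < β) :
    S.ModalDichotomyI β where
  spectrum_union := spectrum_A_eq_union h hβ
  spectrum_disjoint := Set.disjoint_iff_inter_eq_empty.1 (disjoint_sigma h hβ)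
  splitting := ⟨Hhl_invariant, Hll_invariant, isCompl_Hhl_Hll h hβ, restrictedSpectrum_Hll,
    restrictedSpectrum_Hhl⟩
  unique := fun Hh Hl hs => eq_and_eq_of_le_of_sup_eq
    (le_spectralSubspace _ hs.invariant_h hs.spectrum_h.le)
    (le_spectralSubspace _ hs.invariant_l hs.spectrum_l.le) (isCompl_Hhl_Hll h hβ).disjoint
    (by rw [hs.isCompl.sup_eq_top]; exact (isCompl_Hhl_Hll h hβ).sup_eq_top.symm)
  finrank_h := (finrank_Hhl_and_Hll h hβ).1
  finrank_l := Nat.eq_sub_of_add_eq (finrank_Hhl_and_Hll h hβ).2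

end First

end LagrangianSystem

namespace LagrangianSystem

variable {N : ℕ} {S : LagrangianSystem N} {β : ℝ}

/-! #### The second splitting and duality -/

theorem neg_inv_neg_inv (ζ : ℂ) : -(-ζ⁻¹)⁻¹ = ζ := by rw [inv_neg, inv_inv, neg_neg]

theorem neg_inv_mem_spectrum_of_dual (h : S.η.PosDef) {ξ : ℂ}
    (hξ : ξ ∈ spectrum ℂ ((S.dual h).A β)) : -ξ⁻¹ ∈ spectrum ℂ (S.A β) :=
  (S.dual h).neg_inv_mem_spectrum_dual S.α_posDef hξ

theorem norm_pos_of_mem_spectrum (h : S.η.PosDef) {ζ : ℂ} (hζ : ζ ∈ spectrum ℂ (S.A β)) :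
    0 < ‖ζ‖ := by
  rw [norm_pos_iff]
  rintro rfl
  exact S.zero_notMem_spectrum_A h β hζ

theorem sigmaLow_subset_sigma0 (h : S.η.PosDef) : S.sigmaLow β ⊆ S.sigma0 β := by
  rintro ζ ⟨h1, h2⟩
  refine ⟨h1, ?_⟩
  have h3 : ‖ζ‖ < S.omegaMin := h2
  have h4 := S.omegaMin_le_omegaMax h
  rw [mem_closedBall_zero_iff]
  linarith

theorem sigmaMid_subset_sigma0 : S.sigmaMid β ⊆ S.sigma0 β := by
  rintro ζ ⟨h1, h2⟩
  exact ⟨h1, mem_closedBall_zero_iff.2 h2.2⟩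

theorem sigma0_eq_union (h : S.η.PosDef) : S.sigma0 β = S.sigmaLow β ∪ S.sigmaMid β := by
  refine Set.Subset.antisymm ?_ (Set.union_subset (sigmaLow_subset_sigma0 h) sigmaMid_subset_sigma0)
  rintro ζ ⟨h1, h2⟩
  rcases lt_or_ge ‖ζ‖ S.omegaMin with h3 | h3
  · exact Or.inl ⟨h1, h3⟩
  · exact Or.inr ⟨h1, h3, mem_closedBall_zero_iff.1 h2⟩

theorem disjoint_sigmaLow_sigmaMid : Disjoint (S.sigmaLow β) (S.sigmaMid β) := by
  rw [Set.disjoint_left]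
  rintro ζ ⟨-, h1⟩ ⟨-, h2, -⟩
  exact absurd h1 (not_lt.2 h2)

/-- Replaces the discs by a condition on the modulus alone, which inversion and conjugation respect.
-/
theorem mem_sigma1_iff (h : S.η.PosDef) (hβ : 2 * S.omegaMax / S.bMin < β) {ζ : ℂ} :
    ζ ∈ S.sigma1 β ↔ ζ ∈ spectrum ℂ (S.A β) ∧ S.omegaMax < ‖ζ‖ := by
  constructor
  · intro h1
    refine ⟨h1.1, ?_⟩
    by_contra! h2
    exact Set.disjoint_left.1 (disjoint_sigma h hβ) ⟨h1.1, mem_closedBall_zero_iff.2 h2⟩ h1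
  · rintro ⟨h1, h2⟩
    rw [spectrum_A_eq_union h hβ] at h1
    rcases h1 with h1 | h1
    · exact absurd (norm_le_of_mem_sigma0 h1) (not_le.2 h2)
    · exact h1

theorem sigmaLow_eq_image (h : S.η.PosDef)
    (hβ' : 2 * (S.dual h).omegaMax / (S.dual h).bMin < β) :
    S.sigmaLow β = (fun ζ => -ζ⁻¹) '' (S.dual h).sigma1 β := by
  have hω := S.omegaMin_pos h
  ext ζ
  constructor
  · rintro ⟨h1, h2⟩
    refine ⟨-ζ⁻¹, (mem_sigma1_iff S.α_posDef hβ').2 ⟨S.neg_inv_mem_spectrum_dual h h1, ?_⟩,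
      neg_inv_neg_inv ζ⟩
    rw [dual_omegaMax, norm_neg, norm_inv]
    exact (inv_lt_inv₀ hω (norm_pos_of_mem_spectrum h h1)).2 h2
  · rintro ⟨ξ, hξ, rfl⟩
    obtain ⟨h1, h2⟩ := (mem_sigma1_iff S.α_posDef hβ').1 hξ
    refine ⟨neg_inv_mem_spectrum_of_dual h h1, ?_⟩
    rw [dual_omegaMax] at h2
    change ‖-ξ⁻¹‖ < _
    rw [norm_neg, norm_inv]
    exact (inv_lt_comm₀ hω ((inv_pos.2 hω).trans h2)).1 h2

theorem sigma1_eq_image (h : S.η.PosDef) (hβ : 2 * S.omegaMax / S.bMin < β) :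
    S.sigma1 β = (fun ζ => -ζ⁻¹) '' (S.dual h).sigmaLow β := by
  have h1 : (S.dual h).sigmaLow β = (fun ζ => -ζ⁻¹) '' S.sigma1 β :=
    sigmaLow_eq_image (S := S.dual h) S.α_posDef hβ
  rw [h1, Set.image_image]
  simp only [neg_inv_neg_inv, Set.image_id']

theorem neg_inv_mem_sigmaMid_dual (h : S.η.PosDef) {ζ : ℂ} (hζ : ζ ∈ S.sigmaMid β) :
    -ζ⁻¹ ∈ (S.dual h).sigmaMid β := by
  obtain ⟨h1, h2, h3⟩ := hζ
  have hω := S.omegaMin_pos h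
  have hζ0 := norm_pos_of_mem_spectrum h h1
  refine ⟨S.neg_inv_mem_spectrum_dual h h1, ?_, ?_⟩
  · rw [dual_omegaMin, norm_neg, norm_inv]
    gcongr
  · rw [dual_omegaMax, norm_neg, norm_inv]
    gcongr

theorem sigmaMid_eq_image (h : S.η.PosDef) :
    S.sigmaMid β = (fun ζ => -ζ⁻¹) '' (S.dual h).sigmaMid β := by
  apply Set.Subset.antisymm
  · intro ζ hζ
    exact ⟨-ζ⁻¹, neg_inv_mem_sigmaMid_dual h hζ, neg_inv_neg_inv ζ⟩
  · rintro _ ⟨ξ, hξ, rfl⟩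
    exact neg_inv_mem_sigmaMid_dual (S := S.dual h) S.α_posDef hξ

theorem eq_image_neg_conj {s : Set ℂ} (hs : ∀ ζ ∈ s, -(starRingEnd ℂ) ζ ∈ s) :
    s = (fun ζ => -(starRingEnd ℂ) ζ) '' s := by
  apply Set.Subset.antisymm
  · intro ζ hζ
    exact ⟨_, hs ζ hζ, by simp⟩
  · rintro _ ⟨ξ, hξ, rfl⟩
    exact hs ξ hξ

theorem norm_neg_conj (ζ : ℂ) : ‖-(starRingEnd ℂ) ζ‖ = ‖ζ‖ := by
  rw [norm_neg, RCLike.norm_conj]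

theorem restrictedSpectrum_Hll0 : restrictedSpectrum (S.A β) (S.Hll0 β) = S.sigmaLow β :=
  restrictedSpectrum_spectralSubspace _ Set.inter_subset_left

theorem restrictedSpectrum_Hll1 : restrictedSpectrum (S.A β) (S.Hll1 β) = S.sigmaMid β :=
  restrictedSpectrum_spectralSubspace _ Set.inter_subset_left

/-! ### Transport of spectral subspaces to the dual system, and dimensions. -/

theorem map_swap_spectralSubspace_le (h : S.η.PosDef) {s t : Set ℂ}
    (hs : s ⊆ spectrum ℂ (S.A β)) (hst : ∀ ζ ∈ s, -ζ⁻¹ ∈ t) :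
    (spectralSubspace (S.A β) s).map (swap : StateSpace N ≃ₗ[ℂ] StateSpace N).toLinearMap
      ≤ spectralSubspace ((S.dual h).A β) t := by
  have hker : LinearMap.ker (S.A β) = ⊥ := by
    rw [LinearMap.ker_eq_bot']
    intro m hm
    by_contra hm0
    exact S.zero_notMem_spectrum_A h β
      (mem_spectrum_iff_exists_eigenvector.2 ⟨m, hm0, by simpa using hm⟩)
  -- `dual_A_swap_A` describes the dual operator on vectors `swap (A z)`, so each element has to be
  -- written as `A z` with `z` in the same subspace.
  have hmap : (spectralSubspace (S.A β) s).map (S.A β) = spectralSubspace (S.A β) s := by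
    refine Submodule.eq_of_le_of_finrank_eq
      (Submodule.map_le_iff_le_comap.2 (spectralSubspace_invariant _ s)) ?_
    exact (Submodule.equivMapOfInjective _ (LinearMap.ker_eq_bot.1 hker) _).finrank_eq.symm
  apply le_spectralSubspace
  · rintro _ ⟨y, hy, rfl⟩
    rw [← hmap] at hy
    obtain ⟨z, hz, rfl⟩ := hy
    rw [LinearEquiv.coe_coe, S.dual_A_swap_A h]
    exact Submodule.neg_mem _ ⟨z, hz, rfl⟩
  · rintro ζ ⟨_, ⟨y, hy, rfl⟩, h0, hζ⟩
    rw [LinearEquiv.coe_coe] at h0 hζ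
    have h1 := (S.dual h).dual_A_swap_of_eigenvector S.α_posDef h0 hζ
    rw [swap_swap] at h1
    have h2 : -ζ⁻¹ ∈ restrictedSpectrum (S.A β) (spectralSubspace (S.A β) s) :=
      ⟨y, hy, by simpa using h0, h1⟩
    rw [restrictedSpectrum_spectralSubspace _ hs] at h2
    simpa only [neg_inv_neg_inv] using hst _ h2

theorem finrank_spectralSubspace_le_dual (h : S.η.PosDef) {s t : Set ℂ}
    (hs : s ⊆ spectrum ℂ (S.A β)) (hst : ∀ ζ ∈ s, -ζ⁻¹ ∈ t) :
    Module.finrank ℂ (spectralSubspace (S.A β) s)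
      ≤ Module.finrank ℂ (spectralSubspace ((S.dual h).A β) t) := by
  rw [← LinearEquiv.finrank_map_eq (swap (N := N)) (spectralSubspace (S.A β) s)]
  exact Submodule.finrank_mono (map_swap_spectralSubspace_le h hs hst)

theorem finrank_Hll0 (h : S.η.PosDef)
    (hβ' : 2 * (S.dual h).omegaMax / (S.dual h).bMin < β) :
    Module.finrank ℂ (S.Hll0 β) = S.R.rank := by
  have h1 : Module.finrank ℂ ((S.dual h).Hhl β) = S.R.rank :=
    (finrank_Hhl_and_Hll (S := S.dual h) S.α_posDef hβ').1
  have himg := sigmaLow_eq_image h hβ'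
  rw [← h1]
  apply le_antisymm
  · refine finrank_spectralSubspace_le_dual h Set.inter_subset_left fun ζ hζ => ?_
    rw [himg] at hζ
    obtain ⟨ξ, hξ, rfl⟩ := hζ
    simpa only [neg_inv_neg_inv] using hξ
  · refine finrank_spectralSubspace_le_dual (S := S.dual h) S.α_posDef Set.inter_subset_left
      fun ζ hζ => ?_
    rw [himg]
    exact ⟨ζ, hζ, rfl⟩

theorem Hll0_sup_Hll1 (h : S.η.PosDef) : S.Hll0 β ⊔ S.Hll1 β = S.Hll β := by
  rw [Hll0, Hll1, Hll, ← spectralSubspace_union, ← sigma0_eq_union h]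

theorem disjoint_Hll0_Hll1 : Disjoint (S.Hll0 β) (S.Hll1 β) :=
  disjoint_spectralSubspace _ disjoint_sigmaLow_sigmaMid

theorem finrank_Hll1 (h : S.η.PosDef) (hβ : 2 * S.omegaMax / S.bMin < β)
    (hβ' : 2 * (S.dual h).omegaMax / (S.dual h).bMin < β) :
    Module.finrank ℂ (S.Hll1 β) = 2 * N - 2 * S.R.rank := by
  have h1 := Submodule.finrank_sup_add_finrank_inf_eq (S.Hll0 β) (S.Hll1 β)
  rw [Hll0_sup_Hll1 h, disjoint_Hll0_Hll1.eq_bot, finrank_bot, finrank_Hll0 h hβ'] at h1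
  have h2 := (finrank_Hhl_and_Hll h hβ).2
  omega

theorem modalDichotomyII (h : S.η.PosDef) (hβ : 2 * S.omegaMax / S.bMin < β)
    (hβ' : 2 * (S.dual h).omegaMax / (S.dual h).bMin < β) : S.ModalDichotomyII h β where
  splitting := ⟨spectralSubspace_invariant _ _, spectralSubspace_invariant _ _, Hll0_sup_Hll1 h,
    disjoint_Hll0_Hll1, restrictedSpectrum_Hll0, restrictedSpectrum_Hll1⟩
  unique := fun H0 H1 hs => eq_and_eq_of_le_of_sup_eq
    (le_spectralSubspace _ hs.invariant_0 hs.spectrum_0.le)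
    (le_spectralSubspace _ hs.invariant_1 hs.spectrum_1.le) disjoint_Hll0_Hll1
    (by rw [hs.sup_eq]; exact (Hll0_sup_Hll1 h).symm)
  finrank_0 := finrank_Hll0 h hβ'
  finrank_1 := finrank_Hll1 h hβ hβ'
  symm_0 := by
    refine eq_image_neg_conj ?_
    rw [restrictedSpectrum_Hll0]
    rintro ζ ⟨h1, h2⟩
    exact ⟨S.neg_conj_mem_spectrum h1, by simpa only [Set.mem_ofPred_eq, norm_neg_conj] using h2⟩
  dual_0 := by
    rw [restrictedSpectrum_Hll0, restrictedSpectrum_Hhl]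
    exact sigmaLow_eq_image h hβ'
  symm_h := by
    refine eq_image_neg_conj ?_
    rw [restrictedSpectrum_Hhl]
    intro ζ hζ
    rw [mem_sigma1_iff h hβ] at hζ ⊢
    rw [norm_neg_conj]
    exact ⟨S.neg_conj_mem_spectrum hζ.1, hζ.2⟩
  dual_h := by
    rw [restrictedSpectrum_Hll0, restrictedSpectrum_Hhl]
    exact sigma1_eq_image h hβ
  symm_1 := by
    refine eq_image_neg_conj ?_
    rw [restrictedSpectrum_Hll1]
    rintro ζ ⟨h1, h2⟩
    exact ⟨S.neg_conj_mem_spectrum h1, by simpa only [Set.mem_ofPred_eq, norm_neg_conj] using h2⟩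
  dual_1 := by
    rw [restrictedSpectrum_Hll1, restrictedSpectrum_Hll1]
    exact sigmaMid_eq_image h

/-! #### The compressed operator -/

theorem compressedOmega_apply (x : StateSpace N) :
    S.compressedOmega x = (LinearMap.ker S.B).starProjection
      (S.Omega ((LinearMap.ker S.B).starProjection x)) := rfl

theorem compressedOmega_isSymmetric : S.compressedOmega.IsSymmetric := by
  intro x y
  have hP := (LinearMap.ker S.B).starProjection_isSymmetric
  rw [compressedOmega_apply, compressedOmega_apply]
  exact (hP _ _).trans ((S.Omega_isSymmetric _ _).trans (hP _ _))

variable (S) in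
/-- The kernel of the compression of `Ω` to `Ker B`. -/
noncomputable def compressedKer : Submodule ℂ (StateSpace N) :=
  LinearMap.ker S.B ⊓ LinearMap.ker S.compressedOmega

theorem finrank_orthogonal_ker_B : Module.finrank ℂ ((LinearMap.ker S.B)ᗮ : Submodule ℂ _)
    = S.R.rank := by
  have e3 := Submodule.finrank_add_finrank_orthogonal (LinearMap.ker S.B)
  have e5 := S.finrank_ker_B
  rw [finrank_stateSpace] at e3
  omega

/-- `Ω` is injective and maps this kernel into `(Ker B)ᗮ`, whose dimension is `N_R`. -/
theorem finrank_compressedKer_le (h : S.η.PosDef) :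
    Module.finrank ℂ S.compressedKer ≤ S.R.rank := by
  have hker : LinearMap.ker S.Omega = ⊥ := by
    rw [LinearMap.ker_eq_bot']
    intro m hm
    by_contra hm0
    exact S.zero_notMem_spectrum_Omega h
      (mem_spectrum_iff_exists_eigenvector.2 ⟨m, hm0, by simpa using hm⟩)
  rw [← finrank_orthogonal_ker_B, 
    (Submodule.equivMapOfInjective _ (LinearMap.ker_eq_bot.1 hker) S.compressedKer).finrank_eq]
  refine Submodule.finrank_mono ?_
  rintro _ ⟨x, ⟨hx1, hx2⟩, rfl⟩
  rw [SetLike.mem_coe, LinearMap.mem_ker, compressedOmega_apply,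
    Submodule.starProjection_eq_self_iff.2 hx1] at hx2
  exact (Submodule.starProjection_apply_eq_zero_iff _).1 hx2

theorem inner_conjState (x y : StateSpace N) :
    inner ℂ (conjState x) (conjState y) = inner ℂ y x := by
  simp only [conjState, PiLp.inner_apply, Pi.star_apply, RCLike.inner_apply]
  refine Finset.sum_congr rfl fun i _ => ?_
  simp [mul_comm]

theorem conjState_conjState (x : StateSpace N) : conjState (conjState x) = x := by
  ext i; simp [conjState]

theorem conjState_add (x y : StateSpace N) :
    conjState (x + y) = conjState x + conjState y := by
  ext i; simp [conjState]

theorem Omega_conjState (x : StateSpace N) : S.Omega (conjState x) = -conjState (S.Omega x) := by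
  rw [← A_zero, A_conjState]

/-- Both `A(1)` and `Ω` anticommute with conjugation; compare them on `x`. -/
theorem conjState_mem_ker_B {x : StateSpace N} (hx : x ∈ LinearMap.ker S.B) :
    conjState x ∈ LinearMap.ker S.B := by
  have h1 := S.A_conjState 1 x
  rw [A_apply, A_apply, Omega_conjState, LinearMap.mem_ker.1 hx, smul_zero, sub_zero,
    sub_eq_self, smul_eq_zero] at h1
  exact h1.resolve_left (by simp)

theorem starProjection_conjState (x : StateSpace N) :
    (LinearMap.ker S.B).starProjection (conjState x)
      = conjState ((LinearMap.ker S.B).starProjection x) := by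
  refine Submodule.eq_starProjection_of_mem_orthogonal'
    (z := conjState ((LinearMap.ker S.B)ᗮ.starProjection x))
    (conjState_mem_ker_B (Submodule.starProjection_apply_mem _ x)) (fun w hw => ?_) ?_
  · rw [← conjState_conjState w, inner_conjState]
    exact Submodule.inner_left_of_mem_orthogonal (conjState_mem_ker_B hw)
      (Submodule.starProjection_apply_mem _ x)
  · rw [← conjState_add, Submodule.starProjection_add_starProjection_orthogonal]

theorem neg_mem_spectrum_compressedOmega {μ : ℝ}
    (h : (μ : ℂ) ∈ spectrum ℂ S.compressedOmega) :
    ((-μ : ℝ) : ℂ) ∈ spectrum ℂ S.compressedOmega := by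
  obtain ⟨w, hw0, hw⟩ := mem_spectrum_iff_exists_eigenvector.1 h
  refine mem_spectrum_iff_exists_eigenvector.2 ⟨conjState w, mt conjState_eq_zero.1 hw0, ?_⟩
  have hneg : ∀ y : StateSpace N, -conjState y = conjState (-y) := fun y => by
    ext i; simp [conjState]
  rw [compressedOmega_apply, starProjection_conjState, Omega_conjState, hneg,
    starProjection_conjState, map_neg, ← compressedOmega_apply, hw, ← neg_smul, conjState_smul]
  simp

/-- Without a positive eigenvalue the symmetric spectrum would be `{0}` and the compression zero, so
`2N - N_R = dim Ker B ≤ N_R`, against `N_R < N`. -/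
theorem isLeast_rhoMin (h : S.η.PosDef) (hR : S.R.rank < N) :
    IsLeast {ρ : ℝ | 0 < ρ ∧ (ρ : ℂ) ∈ spectrum ℂ S.compressedOmega} S.rhoMin := by
  refine isLeast_sInf_of_subset_finite ?_ (finite_setOf_ofReal_mem_spectrum S.compressedOmega)
    fun _ hρ => hρ.2
  by_contra hne
  have h0 : ∀ μ : ℝ, (μ : ℂ) ∈ spectrum ℂ S.compressedOmega → |μ| ≤ 0 := by
    intro μ hμ
    by_contra! hμ0
    refine hne ⟨|μ|, hμ0, ?_⟩
    rcases abs_choice μ with h1 | h1 <;> rw [h1]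
    exacts [hμ, neg_mem_spectrum_compressedOmega hμ]
  have hK : LinearMap.ker S.B = S.compressedKer := by
    refine le_antisymm (le_inf le_rfl fun x _ => ?_) inf_le_left
    simpa using compressedOmega_isSymmetric.norm_apply_le le_rfl h0 x
  have h1 := finrank_compressedKer_le h
  rw [← hK] at h1
  have h2 := S.finrank_ker_B
  omega

theorem rhoMin_le_abs (h : S.η.PosDef) (hR : S.R.rank < N) {μ : ℝ}
    (hμ : (μ : ℂ) ∈ spectrum ℂ S.compressedOmega) (hμ0 : μ ≠ 0) : S.rhoMin ≤ |μ| := by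
  refine (isLeast_rhoMin h hR).2 ⟨abs_pos.2 hμ0, ?_⟩
  rcases abs_choice μ with h1 | h1 <;> rw [h1]
  exacts [hμ, neg_mem_spectrum_compressedOmega hμ]

end LagrangianSystem

namespace LagrangianSystem

variable {N : ℕ} {S : LagrangianSystem N} {β : ℝ}

/-! #### Overdamping excluded on the high-Q subspace -/

/-- Positivity of the form is used at `A x`, not at `x`: the component of `A x` off `Ker B` contains
the large term `βBx`, yet is dominated by `PΩx`. -/
theorem norm_orthogonal_le_of_mem_Hll (h : S.η.PosDef) (hβ : 2 * S.omegaMax / S.bMin < β)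
    {x : StateSpace N} (hx : x ∈ S.Hll β) :
    (β * S.bMin - 2 * S.omegaMax) * ‖(LinearMap.ker S.B)ᗮ.starProjection x‖
      ≤ 2 * S.omegaMax * ‖(LinearMap.ker S.B).starProjection x‖ := by
  have hω := S.omegaMax_pos h
  have h1 : ‖(LinearMap.ker S.B)ᗮ.starProjection (S.A β x)‖
      ≤ ‖(LinearMap.ker S.B).starProjection (S.A β x)‖ := by
    rcases eq_or_ne (S.A β x) 0 with h0 | h0
    · simp [h0]
    · have := lossForm_pos_of_mem_Hll h hβ (Hll_invariant x hx) h0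
      rw [lossForm, sub_pos] at this
      exact le_of_sq_le_sq this.le (norm_nonneg _)
  rw [starProjection_A, starProjection_orthogonal_A] at h1
  have h2 := le_norm_smul_B (S := S) (pos_of_lt h hβ) x
  have h3 := norm_sub_norm_le ((Complex.I * (β : ℂ)) • S.B x)
    ((LinearMap.ker S.B)ᗮ.starProjection (S.Omega x))
  rw [norm_sub_rev] at h3
  have h4 := (LinearMap.ker S.B).norm_starProjection_apply_le (S.Omega x)
  have h5 := (LinearMap.ker S.B)ᗮ.norm_starProjection_apply_le (S.Omega x)
  have h6 := S.norm_Omega_le h x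
  have h7 : ‖x‖ ≤ ‖(LinearMap.ker S.B).starProjection x‖
      + ‖(LinearMap.ker S.B)ᗮ.starProjection x‖ := by
    conv_lhs => rw [← (LinearMap.ker S.B).starProjection_add_starProjection_orthogonal x]
    exact norm_add_le _ _
  have h8 := mul_le_mul_of_nonneg_left h7 hω.le
  linarith

variable (S) in
/-- The contribution to `P Ω x` of the component of `x` orthogonal to `Ker B`. -/
noncomputable def coupling (x : StateSpace N) : StateSpace N :=
  (LinearMap.ker S.B).starProjection (S.Omega ((LinearMap.ker S.B)ᗮ.starProjection x))

theorem starProjection_A_eq_add (x : StateSpace N) :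
    (LinearMap.ker S.B).starProjection (S.A β x)
      = S.compressedOmega ((LinearMap.ker S.B).starProjection x) + S.coupling x := by
  rw [starProjection_A, compressedOmega_apply, coupling, ← map_add,
    Submodule.starProjection_eq_self_iff.2 (Submodule.starProjection_apply_mem _ x), ← map_add,
    Submodule.starProjection_add_starProjection_orthogonal]

theorem norm_coupling_le (h : S.η.PosDef) (hβ : 2 * S.omegaMax / S.bMin < β)
    {x : StateSpace N} (hx : x ∈ S.Hll β) :
    ‖S.coupling x‖ ≤ S.c β * ‖(LinearMap.ker S.B).starProjection x‖ := by
  have hω := S.omegaMax_pos h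
  have h0 : 0 < β * S.bMin - 2 * S.omegaMax := sub_pos.2 (two_mul_omegaMax_lt hβ)
  have h1 := norm_orthogonal_le_of_mem_Hll h hβ hx
  have h2 : ‖S.coupling x‖ ≤ S.omegaMax * ‖(LinearMap.ker S.B)ᗮ.starProjection x‖ :=
    ((LinearMap.ker S.B).norm_starProjection_apply_le _).trans (S.norm_Omega_le h _)
  have hc : S.c β = 2 * S.omegaMax ^ 2 / (β * S.bMin - 2 * S.omegaMax) := by
    have hb := S.bMin_pos
    have : β - 2 * S.omegaMax / S.bMin = (β * S.bMin - 2 * S.omegaMax) / S.bMin := by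
      field_simp
    rw [c, this]
    field_simp
  rw [hc, div_mul_eq_mul_div, le_div_iff₀ h0]
  calc ‖S.coupling x‖ * (β * S.bMin - 2 * S.omegaMax)
      ≤ S.omegaMax * ‖(LinearMap.ker S.B)ᗮ.starProjection x‖
        * (β * S.bMin - 2 * S.omegaMax) := by gcongr
    _ = S.omegaMax * ((β * S.bMin - 2 * S.omegaMax)
        * ‖(LinearMap.ker S.B)ᗮ.starProjection x‖) := by ring
    _ ≤ S.omegaMax * (2 * S.omegaMax * ‖(LinearMap.ker S.B).starProjection x‖) := by gcongr
    _ = _ := by ring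

theorem starProjection_ne_zero_of_mem_Hll (h : S.η.PosDef) (hβ : 2 * S.omegaMax / S.bMin < β)
    {x : StateSpace N} (hx : x ∈ S.Hll β) (hx0 : x ≠ 0) :
    (LinearMap.ker S.B).starProjection x ≠ 0 := by
  intro h0
  have := lossForm_pos_of_mem_Hll h hβ hx hx0
  rw [lossForm, h0, norm_zero] at this
  nlinarith [sq_nonneg ‖(LinearMap.ker S.B)ᗮ.starProjection x‖]

theorem c_lt_of_cInv_lt (h : S.η.PosDef) {y : ℝ} (hy : 0 < y) (hβ : S.cInv y < β) :
    S.c β < y := by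
  have hω := S.omegaMax_pos h
  have hb := S.bMin_pos
  have h1 : 2 * S.omegaMax ^ 2 / S.bMin * y⁻¹ < β - 2 * S.omegaMax / S.bMin := by
    rw [cInv] at hβ; linarith
  have h2 : 0 < β - 2 * S.omegaMax / S.bMin := lt_of_le_of_lt (by positivity) h1
  rw [c, ← div_eq_mul_inv, div_lt_comm₀ h2 hy, div_eq_mul_inv]
  exact h1

/-- For an eigenvector `w`, `Pw` solves the eigenvalue equation of `PΩP` up to the coupling term, so
`ζ` is within `c(β) < ρ_min / 2` of a real `μ` in its spectrum. Either `μ = 0`, or `|μ| ≥ ρ_min` and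
the real part dominates. -/
theorem norm_lt_or_abs_im_lt_abs_re (h : S.η.PosDef) (hR : S.R.rank < N)
    (hβ : 2 * S.omegaMax / S.bMin < β) (hc : S.c β < S.rhoMin / 2) {ζ : ℂ}
    (hζ : ζ ∈ S.sigma0 β) : ‖ζ‖ < S.rhoMin / 2 ∨ |ζ.im| < |ζ.re| := by
  rw [← restrictedSpectrum_Hll] at hζ
  obtain ⟨w, hw, hw0, hwζ⟩ := hζ
  have h1 := starProjection_A_eq_add (S := S) (β := β) w
  rw [hwζ, map_smul] at h1
  have h2 : ‖S.compressedOmega ((LinearMap.ker S.B).starProjection w)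
      - ζ • (LinearMap.ker S.B).starProjection w‖
      ≤ S.c β * ‖(LinearMap.ker S.B).starProjection w‖ := by
    rw [h1, sub_add_cancel_left, norm_neg]
    exact norm_coupling_le h hβ hw
  obtain ⟨μ, hμ, hμζ⟩ := compressedOmega_isSymmetric.exists_eigenvalue_near
    (starProjection_ne_zero_of_mem_Hll h hβ hw hw0) h2
  by_cases hμ0 : μ = 0
  · left
    rw [hμ0, Complex.ofReal_zero, sub_zero] at hμζ
    linarith
  · right
    have h3 := rhoMin_le_abs h hR hμ hμ0
    have h4 := (Complex.abs_im_le_norm (ζ - μ)).trans hμζ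
    have h5 := (Complex.abs_re_le_norm (ζ - μ)).trans hμζ
    rw [Complex.sub_im, Complex.ofReal_im, sub_zero] at h4
    rw [Complex.sub_re, Complex.ofReal_re, abs_sub_comm] at h5
    have h6 := abs_sub_abs_le_abs_sub μ ζ.re
    linarith

/-! ### A second form, counting the eigenvalues near zero. -/

variable (S) in
/-- The indefinite form that separates the eigenvalues near `0` from the other low-loss ones. -/
noncomputable def kerForm (x : StateSpace N) : ℝ :=
  ‖S.compressedKer.starProjection ((LinearMap.ker S.B).starProjection x)‖ ^ 2
    - ‖S.compressedKerᗮ.starProjection ((LinearMap.ker S.B).starProjection x)‖ ^ 2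

theorem continuous_kerForm : Continuous S.kerForm := by unfold kerForm; fun_prop

theorem kerForm_smul (c : ℂ) (x : StateSpace N) :
    S.kerForm (c • x) = ‖c‖ ^ 2 * S.kerForm x := by
  simp only [kerForm, map_smul, norm_smul]; ring

theorem compressedOmega_mem_orthogonal (x : StateSpace N) :
    S.compressedOmega x ∈ S.compressedKerᗮ := by
  intro y hy
  rw [← compressedOmega_isSymmetric y x, LinearMap.mem_ker.1 hy.2, inner_zero_left]

theorem rhoMin_mul_norm_le (h : S.η.PosDef) (hR : S.R.rank < N) {x : StateSpace N}
    (hx : x ∈ LinearMap.ker S.B) :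
    S.rhoMin * ‖S.compressedKerᗮ.starProjection x‖ ≤ ‖S.compressedOmega x‖ := by
  set u := S.compressedKerᗮ.starProjection x with hu
  have hsum := S.compressedKer.starProjection_add_starProjection_orthogonal x
  have hK0 := S.compressedKer.starProjection_apply_mem x
  have h1 : S.compressedOmega x = S.compressedOmega u := by
    conv_lhs => rw [← hsum, map_add, LinearMap.mem_ker.1 hK0.2, zero_add]
  have huK : u ∈ LinearMap.ker S.B := by
    have h2 : u = x - S.compressedKer.starProjection x := eq_sub_of_add_eq' hsum
    rw [h2]
    exact Submodule.sub_mem _ hx hK0.1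
  rw [h1]
  refine compressedOmega_isSymmetric.le_norm_apply (isLeast_rhoMin h hR).1.1.le
    (fun _ hμ hμ0 => rhoMin_le_abs h hR hμ hμ0) fun z hz => ?_
  -- On all of `H` the kernel of the compression also contains `(Ker B)ᗮ`. Since `u` lies in `Ker
  -- B`, only the projection of `z` onto `Ker B` enters the inner product.
  have h2 : (LinearMap.ker S.B).starProjection z ∈ S.compressedKer := by
    refine ⟨Submodule.starProjection_apply_mem _ z, ?_⟩
    rw [SetLike.mem_coe, LinearMap.mem_ker, compressedOmega_apply,
      Submodule.starProjection_eq_self_iff.2 (Submodule.starProjection_apply_mem _ z)]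
    exact hz
  rw [← Submodule.starProjection_eq_self_iff.2 huK,
    ← Submodule.inner_starProjection_left_eq_right]
  exact Submodule.inner_right_of_mem_orthogonal h2 (Submodule.starProjection_apply_mem _ x)

/-- The same scheme as `lossForm_A_lt`, now with `s = ρ_min / 2`: `PΩP` takes the role of the large
operator and the coupling, at most `c(β) ‖Px‖`, that of the perturbation. -/
theorem kerForm_A_lt (h : S.η.PosDef) (hR : S.R.rank < N) (hβ : 2 * S.omegaMax / S.bMin < β)
    (hc : S.c β < S.rhoMin / 2) {x : StateSpace N} (hx : x ∈ S.Hll β) (hx0 : x ≠ 0) :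
    S.kerForm (S.A β x) < (S.rhoMin / 2) ^ 2 * S.kerForm x := by
  have hρ := (isLeast_rhoMin h hR).1.1
  have hPx := norm_pos_iff.2 (starProjection_ne_zero_of_mem_Hll h hβ hx hx0)
  have hcx := compressedOmega_mem_orthogonal (S := S) ((LinearMap.ker S.B).starProjection x)
  rw [kerForm, starProjection_A_eq_add, map_add, map_add,
    (Submodule.starProjection_apply_eq_zero_iff _).2 hcx, zero_add,
    Submodule.starProjection_eq_self_iff.2 hcx]
  refine sq_sub_sq_lt_of_perturbation
    (q := ‖S.compressedKerᗮ.starProjection (S.coupling x)‖) (by positivity) (norm_nonneg _) ?_ ?_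
  · have h1 := rhoMin_mul_norm_le h hR
      ((LinearMap.ker S.B).starProjection_apply_mem x)
    have h2 := norm_le_add_norm_add
      (S.compressedOmega ((LinearMap.ker S.B).starProjection x))
      (S.compressedKerᗮ.starProjection (S.coupling x))
    linarith
  · rw [← Submodule.norm_sq_eq_add_norm_sq_starProjection,
      ← Submodule.norm_sq_eq_add_norm_sq_starProjection, ← mul_pow]
    refine pow_lt_pow_left₀ ((norm_coupling_le h hβ hx).trans_lt ?_) (norm_nonneg _) two_ne_zero
    gcongr

variable (S β) in
/-- The low-loss eigenvalues of modulus less than `ρ_min / 2`. -/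
def sigmaSmall : Set ℂ := S.sigma0 β ∩ {ζ | ‖ζ‖ < S.rhoMin / 2}

/-- By the Stein criterion the form is positive on this subspace, which therefore meets
`S.compressedKerᗮ` trivially and has dimension at most that of `S.compressedKer`. -/
theorem finrank_sigmaSmall_le (h : S.η.PosDef) (hR : S.R.rank < N)
    (hβ : 2 * S.omegaMax / S.bMin < β) (hc : S.c β < S.rhoMin / 2) :
    Module.finrank ℂ (spectralSubspace (S.A β) (S.sigmaSmall β)) ≤ S.R.rank := by
  have hρ := (isLeast_rhoMin h hR).1.1
  have hle : spectralSubspace (S.A β) (S.sigmaSmall β) ≤ S.Hll β :=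
    spectralSubspace_mono _ Set.inter_subset_left
  have hinv := spectralSubspace_invariant (S.A β) (S.sigmaSmall β)
  have hpos : ∀ x ∈ spectralSubspace (S.A β) (S.sigmaSmall β), x ≠ 0 → 0 < S.kerForm x := by
    intro x hx hx0
    refine pos_of_stein ((S.A β).restrict hinv :
        Module.End ℂ (spectralSubspace (S.A β) (S.sigmaSmall β)))
      (s := S.rhoMin / 2) (by positivity) ?_ (f := fun y => S.kerForm y)
      (continuous_kerForm.comp continuous_subtype_val) (fun c y => kerForm_smul c _)
      (fun y hy => kerForm_A_lt h hR hβ hc (hle y.2) (by simpa using hy)) (x := ⟨x, hx⟩)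
      (by simpa using hx0)
    intro ζ hζ
    have hsub : S.sigmaSmall β ⊆ spectrum ℂ (S.A β) := fun _ hξ => hξ.1.1
    rw [← restrictedSpectrum_eq_spectrum, restrictedSpectrum_spectralSubspace _ hsub] at hζ
    exact hζ.2
  have hd : Disjoint (spectralSubspace (S.A β) (S.sigmaSmall β)) S.compressedKerᗮ := by
    rw [Submodule.disjoint_def]
    intro x hx hx2
    by_contra hx0
    have h1 := hpos x hx hx0
    have h2 : S.compressedKer.starProjection ((LinearMap.ker S.B).starProjection x) = 0 := by
      rw [Submodule.starProjection_apply_eq_zero_iff]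
      intro y hy
      rw [← Submodule.inner_starProjection_left_eq_right,
        Submodule.starProjection_eq_self_iff.2 hy.1]
      exact hx2 y hy
    rw [kerForm, h2, norm_zero] at h1
    nlinarith [sq_nonneg
      ‖S.compressedKerᗮ.starProjection ((LinearMap.ker S.B).starProjection x)‖]
  have e1 := Submodule.finrank_add_finrank_le_of_disjoint hd
  have e2 := Submodule.finrank_add_finrank_orthogonal S.compressedKer
  have e3 := finrank_compressedKer_le h
  omega

/-- If `|ζ| < ρ_min / 2` for one such `ζ`, all eigenvalues below `ω_min` are as small, and together
with `ζ` they span more than `N_R` dimensions. -/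
theorem abs_im_lt_abs_re_of_cInv_lt (h : S.η.PosDef) (hR : S.R.rank < N)
    (hβ : 2 * S.omegaMax / S.bMin < β)
    (hβ' : 2 * (S.dual h).omegaMax / (S.dual h).bMin < β) (hc : S.cInv (S.rhoMin / 2) < β)
    {ζ : ℂ} (hζ : ζ ∈ S.sigmaMid β) : |ζ.im| < |ζ.re| := by
  have hc' := c_lt_of_cInv_lt h (half_pos (isLeast_rhoMin h hR).1.1) hc
  have hζ0 := sigmaMid_subset_sigma0 hζ
  refine (norm_lt_or_abs_im_lt_abs_re h hR hβ hc' hζ0).resolve_left fun hlt => ?_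
  have h1 : S.sigmaLow β ⊆ S.sigmaSmall β := fun ξ hξ =>
    ⟨sigmaLow_subset_sigma0 h hξ, (lt_of_lt_of_le hξ.2 hζ.2.1).trans hlt⟩
  have h2 : ζ ∉ S.sigmaLow β := fun h3 => Set.disjoint_left.1 disjoint_sigmaLow_sigmaMid h3 hζ
  have hd := disjoint_spectralSubspace (S.A β) (Set.disjoint_singleton_right.2 h2)
  have hsup : spectralSubspace (S.A β) (S.sigmaLow β) ⊔ spectralSubspace (S.A β) {ζ}
      ≤ spectralSubspace (S.A β) (S.sigmaSmall β) :=
    sup_le (spectralSubspace_mono _ h1)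
      (spectralSubspace_mono _ (Set.singleton_subset_iff.2 ⟨hζ0, hlt⟩))
  have e1 := Submodule.finrank_sup_add_finrank_inf_eq (spectralSubspace (S.A β) (S.sigmaLow β))
    (spectralSubspace (S.A β) {ζ})
  rw [hd.eq_bot, finrank_bot] at e1
  have e2 := Submodule.finrank_mono hsup
  have e3 := finrank_sigmaSmall_le h hR hβ hc'
  have e4 : Module.finrank ℂ (spectralSubspace (S.A β) (S.sigmaLow β)) = S.R.rank :=
    finrank_Hll0 h hβ'
  have e5 : 0 < Module.finrank ℂ (spectralSubspace (S.A β) {ζ}) := by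
    obtain ⟨w, hw0, hw⟩ := mem_spectrum_iff_exists_eigenvector.1 hζ.1
    refine Submodule.one_le_finrank_iff.2 ((Submodule.ne_bot_iff _).2 ?_)
    exact ⟨w, mem_spectralSubspace_of_eigenvector (Set.mem_singleton ζ) hw, hw0⟩
  omega

/-- The sector `|Im ζ| < |Re ζ|` is invariant under `ζ ↦ -ζ⁻¹`, so either term of the minimum in
`β₂` suffices. -/
theorem abs_im_lt_abs_re (h : S.η.PosDef) (hR : S.R.rank < N) (hβ : S.beta2 h < β)
    {ζ : ℂ} (hζ : ζ ∈ S.sigmaMid β) : |ζ.im| < |ζ.re| := by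
  obtain ⟨h1, h2⟩ := max_lt_iff.1 hβ
  obtain ⟨h2, h3⟩ := max_lt_iff.1 h2
  rcases min_lt_iff.1 h1 with h1 | h1
  · exact abs_im_lt_abs_re_of_cInv_lt h hR h2 h3 h1 hζ
  · have h4 := abs_im_lt_abs_re_of_cInv_lt (S := S.dual h) S.α_posDef hR h3 h2 h1
      (neg_inv_mem_sigmaMid_dual h hζ)
    have hn : 0 < Complex.normSq ζ := by
      rw [Complex.normSq_pos]
      exact norm_pos_iff.1 (norm_pos_of_mem_spectrum h hζ.1)
    rw [Complex.neg_im, Complex.neg_re, Complex.inv_im, Complex.inv_re, abs_neg, abs_neg, abs_div,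
      abs_div, abs_neg] at h4
    exact (div_lt_div_iff_of_pos_right (abs_pos.2 hn.ne')).1 h4

theorem half_lt_qFactor {ζ : ℂ} (him : ζ.im ≤ 0) (hlt : |ζ.im| < |ζ.re|) :
    ((1 / 2 : ℝ) : EReal) < qFactor ζ := by
  have hζ : ζ ≠ 0 := by rintro rfl; simp at hlt
  rw [qFactor, if_neg hζ]
  split_ifs with h0
  · exact EReal.coe_lt_top _
  · have h1 : 0 < -ζ.im := by
      have := lt_of_le_of_ne him h0
      linarith
    rw [EReal.coe_lt_coe_iff]
    have h2 : 1 < |ζ.re| / (-ζ.im) := by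
      rw [one_lt_div h1]
      rwa [abs_of_nonpos him] at hlt
    linarith

/-! #### Eigenmodes -/

theorem deriv_exp_smul (ζ : ℂ) (q : Fin N → ℂ) :
    deriv (fun t : ℝ => Complex.exp (-Complex.I * ζ * t) • q)
      = fun t : ℝ => Complex.exp (-Complex.I * ζ * t) • ((-Complex.I * ζ) • q) := by
  funext t
  have h1 : HasDerivAt (fun t : ℝ => -Complex.I * ζ * (t : ℂ)) (-Complex.I * ζ) t := by
    simpa using (Complex.ofRealCLM.hasDerivAt (x := t)).const_mul (-Complex.I * ζ)
  have h2 := (h1.cexp.smul_const q).deriv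
  rw [h2, smul_smul]

theorem isEigenmode_of_pencil {ζ : ℂ} {q : Fin N → ℂ} (hq : q ≠ 0)
    (h : (S.α.map Complex.ofReal).mulVec ((ζ ^ 2) • q)
      = ((S.damping β).map Complex.ofReal).mulVec ((-Complex.I * ζ) • q)
        + (S.η.map Complex.ofReal).mulVec q) : S.IsEigenmode β ζ q := by
  refine ⟨hq, ?_, fun t => ?_⟩
  · have : ContDiff ℝ 2 (fun t : ℝ => Complex.exp (-Complex.I * ζ * t)) :=
      (contDiff_const.mul Complex.ofRealCLM.contDiff).cexp
    exact this.smul contDiff_const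
  · rw [deriv_exp_smul, deriv_exp_smul]
    change (S.α.map Complex.ofReal).mulVec _ + ((S.damping β).map Complex.ofReal).mulVec _ + _ = 0
    have hη : (S.η.map Complex.ofReal).mulVec q = (S.α.map Complex.ofReal).mulVec ((ζ ^ 2) • q)
        - ((S.damping β).map Complex.ofReal).mulVec ((-Complex.I * ζ) • q) :=
      eq_sub_of_add_eq' h.symm
    have hk : -Complex.I * ζ * (-Complex.I * ζ) = -ζ ^ 2 := by
      linear_combination ζ ^ 2 * Complex.I_sq
    beta_reduce
    rw [Matrix.mulVec_smul (S.α.map _), Matrix.mulVec_smul ((S.damping β).map _) (Complex.exp _),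
      Matrix.mulVec_smul (S.η.map _), ← smul_add, ← smul_add, hη,
      smul_smul _ _ q, hk, neg_smul, Matrix.mulVec_neg]
    simp

/-- For an eigenvector `(p, z)` take `q = K_p p`. The lower row gives `ζ z = i K_q q`; the upper row
times `ζ √α` is then the quadratic eigenvalue equation for `q`. If `q = 0`, then `p = 0` and, as `ζ
≠ 0`, also `z = 0`. -/
theorem exists_isEigenmode (h : S.η.PosDef) {ζ : ℂ} (hζ : ζ ∈ spectrum ℂ (S.A β)) :
    ∃ q, S.IsEigenmode β ζ q := by
  obtain ⟨w, hw0, hw⟩ := mem_spectrum_iff_exists_eigenvector.1 hζ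
  have hζ0 := norm_pos_iff.1 (norm_pos_of_mem_spectrum h hζ)
  have hw' : (S.AMatrix β).mulVec (WithLp.ofLp w) = ζ • WithLp.ofLp w := by
    rw [A_eq, Matrix.toLpLin_apply] at hw
    exact congrArg WithLp.ofLp hw
  set p : Fin N → ℂ := WithLp.ofLp w ∘ Sum.inl with hp
  set z : Fin N → ℂ := WithLp.ofLp w ∘ Sum.inr with hz
  have hpz : WithLp.ofLp w = Sum.elim p z := (Sum.elim_comp_inl_inr _).symm
  rw [hpz, AMatrix, Matrix.fromBlocks_mulVec, Sum.elim_comp_inl, Sum.elim_comp_inr] at hw'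
  have e1 : ((-Complex.I) • (S.Kp * S.damping β * S.Kp).map Complex.ofReal).mulVec p
      + ((-Complex.I) • (S.Kp * S.Kq).map Complex.ofReal).mulVec z = ζ • p :=
    congrArg (fun f => f ∘ Sum.inl) hw'
  have e2 : (Complex.I • (S.Kq * S.Kp).map Complex.ofReal).mulVec p
      + (0 : Matrix (Fin N) (Fin N) ℂ).mulVec z = ζ • z :=
    congrArg (fun f => f ∘ Sum.inr) hw'
  have one : (1 : Matrix (Fin N) (Fin N) ℝ).map Complex.ofReal = 1 :=
    Matrix.map_one _ Complex.ofReal_zero Complex.ofReal_one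
  set q : Fin N → ℂ := (S.Kp.map Complex.ofReal).mulVec p with hq
  have hpq : p = ((CFC.sqrt S.α).map Complex.ofReal).mulVec q := by
    rw [hq, Matrix.mulVec_mulVec, ← map_ofReal_mul, sqrt_mul_Kp, one, Matrix.one_mulVec]
  rw [Matrix.zero_mulVec, add_zero, Matrix.smul_mulVec, map_ofReal_mul, ← Matrix.mulVec_mulVec,
    ← hq] at e2
  rw [Matrix.smul_mulVec, Matrix.smul_mulVec, map_ofReal_mul, ← Matrix.mulVec_mulVec, ← hq,
    map_ofReal_mul, ← Matrix.mulVec_mulVec, map_ofReal_mul, ← Matrix.mulVec_mulVec] at e1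
  have hq0 : q ≠ 0 := by
    intro hq0
    rw [hq0, Matrix.mulVec_zero, smul_zero, eq_comm, smul_eq_zero] at e2
    rw [hq0, Matrix.mulVec_zero] at hpq
    refine hw0 ((WithLp.ofLp_eq_zero 2).1 ?_)
    rw [hpz, hpq, e2.resolve_left hζ0]
    ext (i | i) <;> rfl
  refine ⟨q, isEigenmode_of_pencil hq0 ?_⟩
  have e3 := congrArg (fun y => ζ • ((CFC.sqrt S.α).map Complex.ofReal).mulVec y) e1
  simp only [Matrix.mulVec_add, Matrix.mulVec_smul, Matrix.mulVec_mulVec, ← Matrix.mul_assoc,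
    ← map_ofReal_mul, sqrt_mul_Kp, Matrix.one_mul] at e3
  have e4 : ζ • (S.Kq.map Complex.ofReal).mulVec z
      = Complex.I • (S.η.map Complex.ofReal).mulVec q := by
    rw [← Matrix.mulVec_smul, ← e2, Matrix.mulVec_smul, Matrix.mulVec_mulVec, ← map_ofReal_mul]
    congr 3
    exact S.η_posSemidef.sqrt_mul_sqrt
  have e5 : ((CFC.sqrt S.α).map Complex.ofReal).mulVec p = (S.α.map Complex.ofReal).mulVec q := by
    rw [hpq, Matrix.mulVec_mulVec, ← map_ofReal_mul, S.α_posDef.posSemidef.sqrt_mul_sqrt]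
  rw [e5, smul_add, smul_comm ζ _ ((S.Kq.map Complex.ofReal).mulVec z), e4, smul_smul, smul_smul,
    smul_smul] at e3
  rw [Matrix.mulVec_smul, Matrix.mulVec_smul, pow_two, ← e3]
  simp [mul_comm]

end LagrangianSystem

/-! ### Assembly of the theorem. -/

theorem mainTheorem5 {N : ℕ} (S : LagrangianSystem N) (hη : S.η.PosDef) (hR : S.R.rank < N) :
    (∀ β : ℝ, S.beta2 hη < β →
      S.ModalDichotomyI β ∧
      S.ModalDichotomyII hη β ∧
      (∃ m : EReal, IsLeast (qFactor '' restrictedSpectrum (S.A β) (S.Hll1 β)) m ∧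
        ((1 / 2 : ℝ) : EReal) < m) ∧
      (∀ ζ ∈ restrictedSpectrum (S.A β) (S.Hll1 β),
        ((1 / 2 : ℝ) : EReal) < qFactor ζ ∧ ζ.re ≠ 0)) ∧
    (∀ ζ : ℝ → ℂ,
      (∀ β : ℝ, S.beta2 hη < β → ζ β ∈ restrictedSpectrum (S.A β) (S.Hll1 β)) →
        S.IsUnderdamped ζ) := by
  have key : ∀ β : ℝ, S.beta2 hη < β → ∀ ζ ∈ restrictedSpectrum (S.A β) (S.Hll1 β),
      ((1 / 2 : ℝ) : EReal) < qFactor ζ ∧ ζ.re ≠ 0 := by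
    intro β hβ ζ hζ
    have hβ0 : 0 < β :=
      LagrangianSystem.pos_of_lt hη ((le_max_left _ _).trans_lt (max_lt_iff.1 hβ).2)
    rw [LagrangianSystem.restrictedSpectrum_Hll1] at hζ
    have h1 := LagrangianSystem.abs_im_lt_abs_re hη hR hβ hζ
    exact ⟨LagrangianSystem.half_lt_qFactor (S.im_nonpos_of_mem_spectrum hβ0.le hζ.1) h1,
      abs_pos.1 ((abs_nonneg _).trans_lt h1)⟩
  refine ⟨fun β hβ => ?_, fun ζ hζ => ?_⟩
  · have h1 := (le_max_left _ _).trans_lt (max_lt_iff.1 hβ).2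
    have h2 := (le_max_right _ _).trans_lt (max_lt_iff.1 hβ).2
    refine ⟨LagrangianSystem.modalDichotomyI hη h1, LagrangianSystem.modalDichotomyII hη h1 h2,
      ?_, key β hβ⟩
    have hfin : (qFactor '' restrictedSpectrum (S.A β) (S.Hll1 β)).Finite :=
      ((Module.End.finite_spectrum (S.A β)).subset
        (restrictedSpectrum_subset_spectrum _ _)).image _
    -- The dimension `2N - 2 N_R` is positive because `N_R < N`.
    have hne : (restrictedSpectrum (S.A β) (S.Hll1 β)).Nonempty := by
      rw [LagrangianSystem.restrictedSpectrum_Hll1]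
      by_contra! h0
      have h3 := LagrangianSystem.finrank_Hll1 hη h1 h2
      rw [LagrangianSystem.Hll1, h0, spectralSubspace, iSup_emptyset, finrank_bot] at h3
      omega
    obtain ⟨m, hm, hle⟩ := Set.exists_min_image _ id hfin (hne.image _)
    refine ⟨m, ⟨hm, hle⟩, ?_⟩
    obtain ⟨ζ, hζ, rfl⟩ := hm
    exact (key β hβ ζ hζ).1
  · refine ⟨max 0 (S.beta2 hη), le_max_left _ _, fun β hβ => ?_⟩
    have hβ2 := (le_max_right _ _).trans_lt hβ
    exact ⟨LagrangianSystem.exists_isEigenmode hη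
      (restrictedSpectrum_subset_spectrum _ _ (hζ β hβ2)), (key β hβ2 _ (hζ β hβ2)).2⟩
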